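/- Let $B_N\subset \mathrm{GL}_N=\mathrm{GL}_N(\mathbb C)$ be the subgroup of upper triangular matrices. For integers $0<d<N$ and $w=(\ell_1<\dots<\ell_d)$ with $1\le \ell_1$, $\ell_d\le N$, let $X(w)\subset\mathbb P(\bigwedge^d\mathbb C^N)$ be the Schubert variety, i.e. the Zariski closure of the orbit $B_N\cdot[e_{\ell_1}\wedge\dots\wedge e_{\ell_d}]$. A Levi–Schubert quadruple $(w,d,N,L)$ consists of such $d$, $N$, $w$ and of a standard Levi subgroup $L=\mathrm{GL}_{N_1}\times\dots\times\mathrm{GL}_{N_b}$ (block diagonal matrices, $N_1+\dots+N_b=N$) of $\mathrm{GL}_N$. It is stable if $X(w)$ is $L$-stable for left multiplication. A stable quadruple is spherical if $X(w)$ is a spherical $L$-variety, that is, $X(w)$ is normal and has an open dense orbit for a Borel subgroup of $L$ (the Borel subgroups of $L$ being the $L$-conjugates of $B_N\cap L$). Assume that $w\neq(1,\dots,d)$ and let $0\le p<d$ be the largest integer such that $w=(1,\dots,p,\ell_{p+1},\dots,\ell_d)$. The reduction $(\overline w,\overline d,\overline N,\overline L)$ of $(w,d,N,L)$ is given by $$\overline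 w=(\ell_{p+1}-p,\dots,\ell_d-p),\qquad \overline d=d-p,\qquad \overline N=\ell_d-p,$$ and $\overline L\subset\mathrm{GL}_{\overline N}$ is the image of $L$ under the projection $\mathrm{pr}_w$ onto the middle diagonal block of $\mathrm{GL}_p\times\mathrm{GL}_{\ell_d-p}\times\mathrm{GL}_{N-\ell_d}$. **Proposition.** Let $(w,d,N,L)$ be a stable Levi–Schubert quadruple with $w\ne(1,\dots,d)$. Then $L\subseteq\mathrm{GL}_p\times\mathrm{GL}_{\ell_d-p}\times\mathrm{GL}_{N-\ell_d}$ (so that $\mathrm{pr}_w$ is defined on all of $L$), the reduction $(\overline w,\overline d,\overline N,\overline L)$ is again a stable Levi–Schubert quadruple, and $(w,d,N,L)$ is spherical if and only if $(\overline w,\overline d,\overline N,\overline L)$ is spherical. -/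

import Mathlib

open scoped LinearAlgebra.Projectivization Topology

noncomputable section

namespace LeviSchubert

/-! ### The Zariski topology, local rings and normality of subsets of a projective space -/

section Projective

variable {V : Type} [AddCommGroup V] [Module ℂ V]

/-- The value at `v` of a polynomial in the linear functionals on `V`, that is, of a
polynomial function on `V`. -/
def polyEval (F : MvPolynomial (Module.Dual ℂ V) ℂ) (v : V) : ℂ :=
  MvPolynomial.eval (fun f => f v) F

/-- The set of points of `ℙ(V)` where the (homogeneous) polynomial `F` does not vanish. -/
def nonvanishing (F : MvPolynomial (Module.Dual ℂ V) ℂ) : Set (ℙ ℂ V) :=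
  {x | polyEval F x.rep ≠ 0}

variable (V) in
/-- The Zariski topology on `ℙ(V)`: the sets where a homogeneous polynomial does not vanish
are a basis of open sets. -/
@[reducible] def zariski : TopologicalSpace (ℙ ℂ V) :=
  TopologicalSpace.generateFrom
    {U | ∃ (n : ℕ) (F : MvPolynomial (Module.Dual ℂ V) ℂ),
      F.IsHomogeneous n ∧ U = nonvanishing F}

/-- The function `F / G` on `ℙ(V)`, meaningful where `G` does not vanish if `F` and `G` are
homogeneous of the same degree. -/
def ratio (F G : MvPolynomial (Module.Dual ℂ V) ℂ) (y : ℙ ℂ V) : ℂ :=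
  polyEval F y.rep / polyEval G y.rep

/-- The neighbourhoods of `x` in `X` for the Zariski topology. -/
def zariskiNhds (X : Set (ℙ ℂ V)) (x : ℙ ℂ V) : Filter (ℙ ℂ V) :=
  @nhdsWithin _ (zariski V) x X

theorem eventually_nonvanishing (X : Set (ℙ ℂ V)) (x : ℙ ℂ V)
    {n : ℕ} {G : MvPolynomial (Module.Dual ℂ V) ℂ} (hG : G.IsHomogeneous n)
    (hx : polyEval G x.rep ≠ 0) : ∀ᶠ y in zariskiNhds X x, polyEval G y.rep ≠ 0 := by
  let _ := zariski V
  have h : IsOpen (nonvanishing G) := TopologicalSpace.isOpen_generateFrom_of_mem ⟨n, G, hG, rfl⟩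
  exact mem_nhdsWithin_of_mem_nhds (h.mem_nhds hx)

/-- The local ring of `X ⊆ ℙ(V)` at `x`: germs at `x` of functions on `X` that are quotients
`F / G` of homogeneous polynomials of the same degree with `G(x) ≠ 0`. -/
def localRing (X : Set (ℙ ℂ V)) (x : ℙ ℂ V) : Subring (Filter.Germ (zariskiNhds X x) ℂ) where
  carrier := {φ | ∃ (n : ℕ) (F G : MvPolynomial (Module.Dual ℂ V) ℂ),
    F.IsHomogeneous n ∧ G.IsHomogeneous n ∧ polyEval G x.rep ≠ 0 ∧
      φ = (↑(ratio F G) : Filter.Germ (zariskiNhds X x) ℂ)}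
  zero_mem' := by
    refine ⟨0, 0, 1, MvPolynomial.isHomogeneous_zero _ _ _, MvPolynomial.isHomogeneous_one _ _,
      by simp [polyEval], ?_⟩
    refine Filter.Germ.coe_eq.2 (Filter.Eventually.of_forall fun y => ?_)
    simp [ratio, polyEval]
  one_mem' := by
    refine ⟨0, 1, 1, MvPolynomial.isHomogeneous_one _ _, MvPolynomial.isHomogeneous_one _ _,
      by simp [polyEval], ?_⟩
    refine Filter.Germ.coe_eq.2 (Filter.Eventually.of_forall fun y => ?_)
    simp [ratio, polyEval]
  neg_mem' := by
    rintro _ ⟨n, F, G, hF, hG, hx, rfl⟩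
    refine ⟨n, -F, G, hF.neg, hG, hx, ?_⟩
    refine Filter.Germ.coe_eq.2 (Filter.Eventually.of_forall fun y => ?_)
    simp [ratio, polyEval, neg_div]
  mul_mem' := by
    rintro _ _ ⟨n, F, G, hF, hG, hx, rfl⟩ ⟨n', F', G', hF', hG', hx', rfl⟩
    refine ⟨n + n', F * F', G * G', hF.mul hF', hG.mul hG', ?_, ?_⟩
    · simp only [polyEval, map_mul] at hx hx' ⊢
      exact mul_ne_zero hx hx'
    · refine Filter.Germ.coe_eq.2 (Filter.Eventually.of_forall fun y => ?_)
      simp [ratio, polyEval, div_mul_div_comm]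
  add_mem' := by
    rintro _ _ ⟨n, F, G, hF, hG, hx, rfl⟩ ⟨n', F', G', hF', hG', hx', rfl⟩
    refine ⟨n + n', F * G' + G * F', G * G', (hF.mul hG').add (hG.mul hF'), hG.mul hG', ?_, ?_⟩
    · simp only [polyEval, map_mul] at hx hx' ⊢
      exact mul_ne_zero hx hx'
    · refine Filter.Germ.coe_eq.2 ?_
      filter_upwards [eventually_nonvanishing X x hG hx, eventually_nonvanishing X x hG' hx']
        with y hy hy'
      simp only [polyEval] at hy hy'
      simp [ratio, polyEval, div_add_div _ _ hy hy']

/-- A subvariety of `ℙ(V)` is normal if all its local rings are integrally closed domains. -/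
def IsNormalVariety (X : Set (ℙ ℂ V)) : Prop :=
  ∀ x ∈ X, IsDomain (localRing X x) ∧ IsIntegrallyClosed (localRing X x)

end Projective

/-! ### Subgroups of `GL_N`

Rows and columns are numbered `0, …, N - 1`. -/

/-- The block upper triangular matrices in `GL_N`: the entry `(i, j)` vanishes whenever
`b j < b i`. -/
def blockTriangularSubgroup {N : ℕ} {α : Type} [LinearOrder α] (b : Fin N → α) :
    Subgroup (GL (Fin N) ℂ) where
  carrier := {g | ∀ i j, b j < b i → g i j = 0}
  one_mem' := fun i j hij => by
    rw [Units.val_one, Matrix.one_apply_ne]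
    rintro rfl
    exact lt_irrefl _ hij
  mul_mem' := fun {g h} hg hh => by
    have hg' : (g : Matrix (Fin N) (Fin N) ℂ).BlockTriangular b := fun i j hij => hg i j hij
    have hh' : (h : Matrix (Fin N) (Fin N) ℂ).BlockTriangular b := fun i j hij => hh i j hij
    intro i j hij
    exact hg'.mul hh' hij
  inv_mem' := fun {g} hg => by
    have hg' : (g : Matrix (Fin N) (Fin N) ℂ).BlockTriangular b := fun i j hij => hg i j hij
    let _ := g.invertible
    intro i j hij
    have := Matrix.blockTriangular_inv_of_blockTriangular hg' hij
    rwa [← Matrix.coe_units_inv] at this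

/-- The standard Borel subgroup of upper triangular matrices. -/
def standardBorel (N : ℕ) : Subgroup (GL (Fin N) ℂ) :=
  blockTriangularSubgroup (fun i : Fin N => i)

/-- The maximal standard parabolic subgroup `P_k`: the entry `(i, j)` vanishes if `j < k ≤ i`,
so the lower left block of size `(N - k) × k` is zero. -/
def maximalParabolic (N k : ℕ) : Subgroup (GL (Fin N) ℂ) :=
  blockTriangularSubgroup (fun i : Fin N => decide (k ≤ i.val))

/-- The opposite of `P_k`: the entry `(i, j)` vanishes if `i < k ≤ j`. -/
def oppositeMaximalParabolic (N k : ℕ) : Subgroup (GL (Fin N) ℂ) :=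
  blockTriangularSubgroup (fun i : Fin N => decide (i.val < k))

/-- The block diagonal matrices with blocks of sizes `k` and `N - k`. -/
def splitAt (N k : ℕ) : Subgroup (GL (Fin N) ℂ) :=
  maximalParabolic N k ⊓ oppositeMaximalParabolic N k

/-- The Levi subgroup `L_I = GL_{N_1} × ⋯ × GL_{N_b}` of the standard parabolic subgroup `P_I`,
where `I` is a set of simple roots `α_k`, `0 < k < N`: the block diagonal matrices whose blocks
are separated at those `k` for which `α_k` is not in `I`. -/
def leviSubgroup (N : ℕ) (I : Set ℕ) : Subgroup (GL (Fin N) ℂ) :=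
  ⨅ k ∈ Set.Ioo 0 N \ I, splitAt N k

/-- `B` is a Borel subgroup of the Levi subgroup `L = GL_{N_1} × ⋯ × GL_{N_b}`: a conjugate in
`L` of the group of upper triangular matrices in `L`. -/
def IsBorelOf {N : ℕ} (L B : Subgroup (GL (Fin N) ℂ)) : Prop :=
  ∃ g ∈ L, B = (standardBorel N ⊓ L).map (MulAut.conj g).toMonoidHom

/-! ### The Plücker space and Schubert varieties -/

/-- The space `⋀^d ℂ^N`. -/
abbrev PluckerSpace (N d : ℕ) : Type := ⋀[ℂ]^d (Fin N → ℂ)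

/-- The action of `GL_N` on `⋀^d ℂ^N` by linear automorphisms. -/
def pluckerRep (N d : ℕ) :
    GL (Fin N) ℂ →* LinearMap.GeneralLinearGroup ℂ (PluckerSpace N d) :=
  MonoidHom.toHomUnits
    { toFun := fun g => exteriorPower.map d (Matrix.toLin' (g : Matrix (Fin N) (Fin N) ℂ))
      map_one' := by
        rw [Units.val_one, Matrix.toLin'_one, exteriorPower.map_id]
        rfl
      map_mul' := fun g h => by
        rw [Units.val_mul, Matrix.toLin'_mul, exteriorPower.map_comp]
        rfl }

/-- The orbit of a point of `ℙ(⋀^d ℂ^N)` under a subgroup of `GL_N`. -/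
def orbit {N d : ℕ} (H : Subgroup (GL (Fin N) ℂ)) (x : ℙ ℂ (PluckerSpace N d)) :
    Set (ℙ ℂ (PluckerSpace N d)) :=
  {y | ∃ h ∈ H, y = pluckerRep N d h • x}

/-- The vector `e_w = e_{w_1} ∧ ⋯ ∧ e_{w_d}`. -/
def basisVector {N d : ℕ} (w : Fin d ↪o Fin N) : PluckerSpace N d :=
  exteriorPower.ιMulti ℂ d (fun i => Pi.single (w i) (1 : ℂ))

theorem basisVector_ne_zero {N d : ℕ} (w : Fin d ↪o Fin N) : basisVector w ≠ 0 := by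
  intro h
  have h1 := exteriorPower.pairingDual_apply_apply_eq_one
    (R := ℂ) (M := Fin N → ℂ) (fun i : Fin N => Pi.single i (1 : ℂ)) (fun i => LinearMap.proj i)
    (by intro i; simp) (by intro i j hij; simp [hij]) (n := d) w
  have h2 : exteriorPower.ιMulti ℂ d ((fun i : Fin N => (Pi.single i (1 : ℂ) : Fin N → ℂ)) ∘ w)
      = 0 := h
  rw [h2, map_zero] at h1
  exact zero_ne_one h1

/-- The torus fixed point `[e_w]`. -/
def basisPoint {N d : ℕ} (w : Fin d ↪o Fin N) : ℙ ℂ (PluckerSpace N d) :=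
  Projectivization.mk ℂ (basisVector w) (basisVector_ne_zero w)

/-- The Schubert variety `X(w)`: the Zariski closure of the orbit `B[e_w]`. -/
def schubertVariety {N d : ℕ} (w : Fin d ↪o Fin N) : Set (ℙ ℂ (PluckerSpace N d)) :=
  @closure _ (zariski (PluckerSpace N d)) (orbit (standardBorel N) (basisPoint w))

/-! ### Spherical varieties -/

/-- `X` is stable under the subgroup `H` of `GL_N`. -/
def IsStableUnder {N d : ℕ} (H : Subgroup (GL (Fin N) ℂ)) (X : Set (ℙ ℂ (PluckerSpace N d))) :
    Prop :=
  ∀ h ∈ H, ∀ x ∈ X, pluckerRep N d h • x ∈ X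

/-- The subset `O` of `X` is open and dense in `X` for the Zariski topology. -/
def IsOpenDenseIn {V : Type} [AddCommGroup V] [Module ℂ V] (O X : Set (ℙ ℂ V)) : Prop :=
  (∃ U : Set (ℙ ℂ V), IsOpen[zariski V] U ∧ O = U ∩ X) ∧ X ⊆ closure[zariski V] O

/-- The `L`-stable subvariety `X` of `ℙ(⋀^d ℂ^N)` is a spherical `L`-variety: it is normal, and
it has an open dense orbit for a Borel subgroup of `L`. -/
def IsSphericalVariety {N d : ℕ} (L : Subgroup (GL (Fin N) ℂ))
    (X : Set (ℙ ℂ (PluckerSpace N d))) : Prop :=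
  IsNormalVariety X ∧
    ∃ B, IsBorelOf L B ∧ ∃ x ∈ X, IsOpenDenseIn (orbit B x) X

/-! ### Block projection -/

/-- The block diagonal matrices in `GL_N` with blocks of sizes `p`, `m - p`, `N - m`. -/
def threeBlocks (N p m : ℕ) : Subgroup (GL (Fin N) ℂ) :=
  splitAt N p ⊓ splitAt N m

/-- The embedding of the indices of the middle block. -/
def midIndex {N m : ℕ} (p : ℕ) (hm : m ≤ N) (i : Fin (m - p)) : Fin N :=
  ⟨i.val + p, by omega⟩

theorem mem_splitAt {N k : ℕ} {g : GL (Fin N) ℂ} :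
    g ∈ splitAt N k ↔ ∀ i j : Fin N, ¬ (i.val < k ↔ j.val < k) → g i j = 0 := by
  have h1 : g ∈ splitAt N k ↔
      (∀ i j : Fin N, decide (k ≤ j.val) < decide (k ≤ i.val) → g i j = 0) ∧
      (∀ i j : Fin N, decide (j.val < k) < decide (i.val < k) → g i j = 0) := Iff.rfl
  rw [h1]
  constructor
  · rintro ⟨h, h'⟩ i j hij
    by_cases hi : i.val < k
    · exact h' i j (by
        have hj : ¬ j.val < k := fun hj => hij (by simp [hi, hj])
        simp [hi, hj])
    · exact h i j (by
        have hj : j.val < k := by by_contra hj; exact hij (by simp [hi, hj])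
        have hi' : k ≤ i.val := by omega
        have hj' : ¬ k ≤ j.val := by omega
        simp [hi', hj'])
  · intro h
    refine ⟨fun i j hij => h i j ?_, fun i j hij => h i j ?_⟩
    · rw [Bool.lt_iff] at hij
      simp only [decide_eq_false_iff_not, decide_eq_true_eq] at hij
      omega
    · rw [Bool.lt_iff] at hij
      simp only [decide_eq_false_iff_not, decide_eq_true_eq] at hij
      omega

theorem mem_leviSubgroup {N : ℕ} {I : Set ℕ} {g : GL (Fin N) ℂ} :
    g ∈ leviSubgroup N I ↔ ∀ k, 0 < k → k < N → k ∉ I →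
      ∀ i j : Fin N, ¬ (i.val < k ↔ j.val < k) → g i j = 0 := by
  simp only [leviSubgroup, Subgroup.mem_iInf, mem_splitAt, Set.mem_sdiff, Set.mem_Ioo]
  exact ⟨fun h k h1 h2 h3 => h k ⟨⟨h1, h2⟩, h3⟩, fun h k hk => h k hk.1.1 hk.1.2 hk.2⟩

theorem sum_midIndex {N p m : ℕ} (hm : m ≤ N) (f : Fin N → ℂ)
    (hf : ∀ k : Fin N, ¬ (p ≤ k.val ∧ k.val < m) → f k = 0) :
    ∑ k, f k = ∑ k : Fin (m - p), f (midIndex p hm k) := by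
  symm
  refine Fintype.sum_of_injective (midIndex p hm) ?_ _ _ ?_ (fun _ => rfl)
  · intro a b hab
    have := congrArg Fin.val hab
    simp only [midIndex] at this
    exact Fin.ext (by omega)
  · intro k hk
    refine hf k fun h => hk ⟨⟨k.val - p, by omega⟩, ?_⟩
    exact Fin.ext (by simp only [midIndex]; omega)

/-- The projection `GL_p × GL_{m-p} × GL_{N-m} → GL_{m-p}` onto the middle block. -/
def midProj (N p m : ℕ) (hm : m ≤ N) : threeBlocks N p m →* GL (Fin (m - p)) ℂ :=
  MonoidHom.toHomUnits
    { toFun := fun g => (g.1 : Matrix (Fin N) (Fin N) ℂ).submatrix (midIndex p hm) (midIndex p hm)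
      map_one' := by
        ext i j
        simp [Matrix.one_apply, midIndex, Fin.ext_iff]
      map_mul' := fun g h => by
        ext i j
        simp only [Matrix.submatrix_apply, Matrix.mul_apply, Subgroup.coe_mul, Units.val_mul]
        refine sum_midIndex hm _ fun k hk => ?_
        have h1 := mem_splitAt.1 g.2.1 (midIndex p hm i) k
        have h2 := mem_splitAt.1 g.2.2 (midIndex p hm i) k
        simp only [midIndex] at h1 h2 ⊢
        by_cases hkp : k.val < p
        · rw [h1 (by omega), zero_mul]
        · rw [h2 (by omega), zero_mul] }

theorem midProj_apply {N p m : ℕ} (hm : m ≤ N) (g : threeBlocks N p m) (i j : Fin (m - p)) :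
    midProj N p m hm g i j = (g : GL (Fin N) ℂ) (midIndex p hm i) (midIndex p hm j) := rfl

/-- The image of `L` under the projection onto the middle block (of the part of `L` on which
this projection is defined). -/
def midImage {N : ℕ} (p m : ℕ) (hm : m ≤ N) (L : Subgroup (GL (Fin N) ℂ)) :
    Subgroup (GL (Fin (m - p)) ℂ) :=
  (L.subgroupOf (threeBlocks N p m)).map (midProj N p m hm)

/-- The block diagonal matrix with blocks `1`, `A`, `1`. -/
def padMatrix (N p m : ℕ) (A : Matrix (Fin (m - p)) (Fin (m - p)) ℂ) :
    Matrix (Fin N) (Fin N) ℂ :=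
  fun i j =>
    if h : (p ≤ i.val ∧ i.val < m) ∧ (p ≤ j.val ∧ j.val < m) then
      A ⟨i.val - p, by omega⟩ ⟨j.val - p, by omega⟩
    else if i = j then 1 else 0

theorem padMatrix_one (N p m : ℕ) : padMatrix N p m 1 = 1 := by
  ext i j
  simp only [padMatrix, Matrix.one_apply, Fin.ext_iff]
  split_ifs <;> first | rfl | omega

theorem padMatrix_mul {N p m : ℕ} (hm : m ≤ N) (A A' : Matrix (Fin (m - p)) (Fin (m - p)) ℂ) :
    padMatrix N p m A * padMatrix N p m A' = padMatrix N p m (A * A') := by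
  ext i j
  rw [Matrix.mul_apply]
  by_cases hi : p ≤ i.val ∧ i.val < m
  · rw [sum_midIndex (p := p) hm]
    · by_cases hj : p ≤ j.val ∧ j.val < m
      · rw [padMatrix, dif_pos ⟨hi, hj⟩, Matrix.mul_apply]
        refine Finset.sum_congr rfl fun k _ => ?_
        have hk : p ≤ (midIndex p hm k).val ∧ (midIndex p hm k).val < m := by
          simp only [midIndex]; omega
        rw [padMatrix, padMatrix, dif_pos ⟨hi, hk⟩, dif_pos ⟨hk, hj⟩]
        have : (⟨(midIndex p hm k).val - p, by omega⟩ : Fin (m - p)) = k :=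
          Fin.ext (by simp only [midIndex]; omega)
        rw [this]
      · have hij : i ≠ j := by rintro rfl; exact hj hi
        rw [padMatrix, dif_neg (fun h => hj h.2), if_neg hij]
        refine Finset.sum_eq_zero fun k _ => ?_
        have hk : p ≤ (midIndex p hm k).val ∧ (midIndex p hm k).val < m := by
          simp only [midIndex]; omega
        have hkj : midIndex p hm k ≠ j := by rintro rfl; exact hj hk
        have : padMatrix N p m A' (midIndex p hm k) j = 0 := by
          rw [padMatrix, dif_neg (fun h => hj h.2), if_neg hkj]
        rw [this, mul_zero]
    · intro k hk
      have hik : i ≠ k := by rintro rfl; exact hk hi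
      have : padMatrix N p m A i k = 0 := by
        rw [padMatrix, dif_neg (fun h => hk h.2), if_neg hik]
      rw [this, zero_mul]
  · have h1 : ∀ (C : Matrix (Fin (m - p)) (Fin (m - p)) ℂ) (k : Fin N),
        padMatrix N p m C i k = if i = k then 1 else 0 := fun C k => by
      rw [padMatrix, dif_neg (fun h => hi h.1)]
    rw [h1]
    simp [h1]

/-- The element `diag(1, g, 1)` of `GL_N`. -/
def padUnit {N p m : ℕ} (hm : m ≤ N) (g : GL (Fin (m - p)) ℂ) : GL (Fin N) ℂ where
  val := padMatrix N p m g
  inv := padMatrix N p m (g⁻¹ : GL (Fin (m - p)) ℂ)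
  val_inv := by rw [padMatrix_mul hm, Units.mul_inv, padMatrix_one]
  inv_val := by rw [padMatrix_mul hm, Units.inv_mul, padMatrix_one]

theorem padUnit_apply {N p m : ℕ} (hm : m ≤ N) (g : GL (Fin (m - p)) ℂ) (i j : Fin N) :
    padUnit hm g i j = padMatrix N p m g i j := rfl

/-- The projection of a standard Levi subgroup is a standard Levi subgroup. -/
theorem midImage_leviSubgroup {N p m : ℕ} (hm : m ≤ N) (I : Set ℕ) :
    midImage p m hm (leviSubgroup N I) = leviSubgroup (m - p) {k | k + p ∈ I} := by
  ext g
  rw [mem_leviSubgroup]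
  constructor
  · rintro ⟨x, hx, rfl⟩ k hk0 hk1 hkI i j hij
    rw [midProj_apply]
    refine mem_leviSubgroup.1 (Subgroup.mem_subgroupOf.1 hx) (k + p) (by omega) (by omega) hkI _ _ ?_
    simp only [midIndex]
    omega
  · intro hg
    have hsplit : padUnit hm g ∈ threeBlocks N p m := by
      refine ⟨mem_splitAt.2 fun i j hij => ?_, mem_splitAt.2 fun i j hij => ?_⟩ <;>
      · rw [padUnit_apply, padMatrix, dif_neg (by omega), if_neg]
        rintro rfl
        exact hij Iff.rfl
    refine ⟨⟨padUnit hm g, hsplit⟩, Subgroup.mem_subgroupOf.2 (mem_leviSubgroup.2 ?_), ?_⟩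
    · intro k hk0 hk1 hkI i j hij
      have hne : i ≠ j := by
        rintro rfl
        exact hij Iff.rfl
      change padMatrix N p m g i j = 0
      rw [padMatrix]
      split_ifs with h
      · refine hg (k - p) (by omega) (by omega) ?_ _ _ ?_
        · have : k - p + p = k := by omega
          simpa only [Set.mem_ofPred_eq, this] using hkI
        · simp only
          omega
      · rfl
    · ext i j
      rw [midProj_apply]
      change padMatrix N p m g _ _ = _
      have hi : p ≤ (midIndex p hm i).val ∧ (midIndex p hm i).val < m := by
        simp only [midIndex]; omega
      have hj : p ≤ (midIndex p hm j).val ∧ (midIndex p hm j).val < m := by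
        simp only [midIndex]; omega
      rw [padMatrix, dif_pos ⟨hi, hj⟩]
      have h1 : ∀ (k : Fin (m - p)) (h : (midIndex p hm k).val - p < m - p),
          (⟨(midIndex p hm k).val - p, h⟩ : Fin (m - p)) = k := fun k h =>
        Fin.ext (by simp only [midIndex]; omega)
      rw [h1, h1]

end LeviSchubert

open LeviSchubert

/-! ### Levi–Schubert quadruples -/

/-- A Levi–Schubert quadruple `(w, d, N, L)`. The entries of `w = (ℓ_1 < ⋯ < ℓ_d)` are numbered
from `0`: `ℓ_{i+1} = w i + 1`. -/
structure LeviSchubertQuadruple where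
  N : ℕ
  d : ℕ
  d_pos : 0 < d
  d_lt : d < N
  w : Fin d ↪o Fin N
  L : Subgroup (GL (Fin N) ℂ)
  isLevi : ∃ I : Set ℕ, I ⊆ Set.Ioo 0 N ∧ L = leviSubgroup N I

namespace LeviSchubertQuadruple

/-- `w` is the identity, that is, `w = (1, …, d)`. -/
def IsIdentity (Q : LeviSchubertQuadruple) : Prop :=
  ∀ i : Fin Q.d, (Q.w i).val = i.val

/-- The Schubert variety `X(w)`. -/
def X (Q : LeviSchubertQuadruple) : Set (ℙ ℂ (PluckerSpace Q.N Q.d)) :=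
  schubertVariety Q.w

/-- The quadruple is stable: `X(w)` is `L`-stable. -/
def IsStable (Q : LeviSchubertQuadruple) : Prop :=
  IsStableUnder Q.L Q.X

/-- The quadruple is stable, and spherical: `X(w)` is a spherical `L`-variety. -/
def IsSpherical (Q : LeviSchubertQuadruple) : Prop :=
  Q.IsStable ∧ IsSphericalVariety Q.L Q.X

/-- The largest `p` such that `w` begins with `1, …, p`. -/
def p (Q : LeviSchubertQuadruple) : ℕ :=
  Nat.findGreatest (fun p => ∀ i : Fin Q.d, i.val < p → (Q.w i).val = i.val) Q.d

/-- The last entry `ℓ_d` of `w`, numbered from `1`. -/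
def lastEntry (Q : LeviSchubertQuadruple) : ℕ :=
  (Q.w ⟨Q.d - 1, Nat.sub_lt Q.d_pos Nat.one_pos⟩).val + 1

theorem lastEntry_le (Q : LeviSchubertQuadruple) : Q.lastEntry ≤ Q.N :=
  (Q.w _).isLt

theorem le_w (Q : LeviSchubertQuadruple) : ∀ (n : ℕ) (h : n < Q.d), n ≤ (Q.w ⟨n, h⟩).val
  | 0, _ => Nat.zero_le _
  | n + 1, h => by
    have h1 := Q.le_w n (by omega)
    have h2 : Q.w ⟨n, by omega⟩ < Q.w ⟨n + 1, h⟩ := Q.w.lt_iff_lt.2 (by simp)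
    have h3 : (Q.w ⟨n, by omega⟩).val < (Q.w ⟨n + 1, h⟩).val := h2
    omega

theorem w_lt_lastEntry (Q : LeviSchubertQuadruple) (i : Fin Q.d) :
    (Q.w i).val < Q.lastEntry := by
  have h : Q.w i ≤ Q.w ⟨Q.d - 1, Nat.sub_lt Q.d_pos Nat.one_pos⟩ :=
    Q.w.le_iff_le.2 (Fin.le_def.2 (by simp only; omega))
  exact Nat.lt_succ_of_le h

theorem p_le (Q : LeviSchubertQuadruple) : Q.p ≤ Q.d := Nat.findGreatest_le _

theorem p_spec (Q : LeviSchubertQuadruple) (i : Fin Q.d) (hi : i.val < Q.p) :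
    (Q.w i).val = i.val := by
  classical
  exact Nat.findGreatest_spec (P := fun p => ∀ i : Fin Q.d, i.val < p → (Q.w i).val = i.val)
    (Nat.zero_le Q.d) (by intro i hi; omega) i hi

theorem p_lt (Q : LeviSchubertQuadruple) (hne : ¬ Q.IsIdentity) : Q.p < Q.d := by
  refine lt_of_le_of_ne Q.p_le fun h => hne fun i => Q.p_spec i ?_
  rw [h]
  exact i.isLt

theorem d_lt_lastEntry (Q : LeviSchubertQuadruple) (hne : ¬ Q.IsIdentity) :
    Q.d < Q.lastEntry := by
  by_contra hcon
  refine hne fun i => ?_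
  have key : ∀ (k n : ℕ) (h : n < Q.d), n + k + 1 = Q.d → (Q.w ⟨n, h⟩).val ≤ n := by
    intro k
    induction k with
    | zero =>
      intro n h hn
      have := Q.w_lt_lastEntry ⟨n, h⟩
      omega
    | succ k ih =>
      intro n h hn
      have h1 := ih (n + 1) (by omega) (by omega)
      have h2 : Q.w ⟨n, h⟩ < Q.w ⟨n + 1, by omega⟩ := Q.w.lt_iff_lt.2 (by simp)
      have h3 : (Q.w ⟨n, h⟩).val < (Q.w ⟨n + 1, by omega⟩).val := h2
      omega
  have h1 := key (Q.d - 1 - i.val) i.val i.isLt (by omega)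
  have h2 := Q.le_w i.val i.isLt
  exact le_antisymm h1 h2

/-- `w̄ = (ℓ_{p+1} - p, …, ℓ_d - p)`. -/
def reducedW (Q : LeviSchubertQuadruple) : Fin (Q.d - Q.p) ↪o Fin (Q.lastEntry - Q.p) :=
  OrderEmbedding.ofStrictMono
    (fun i => ⟨(Q.w ⟨i.val + Q.p, by omega⟩).val - Q.p, by
      have h1 := Q.w_lt_lastEntry ⟨i.val + Q.p, by omega⟩
      have h2 := Q.le_w (i.val + Q.p) (by omega)
      omega⟩)
    (by
      intro i j hij
      have h1 : Q.w ⟨i.val + Q.p, by omega⟩ < Q.w ⟨j.val + Q.p, by omega⟩ :=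
        Q.w.lt_iff_lt.2 (by rw [Fin.lt_def] at hij ⊢; simp only; omega)
      rw [Fin.lt_def] at h1 ⊢
      have h2 := Q.le_w (i.val + Q.p) (by omega)
      simp only
      omega)

/-- The subgroup `GL_p × GL_{ℓ_d - p} × GL_{N - ℓ_d}` of `GL_N`. -/
def blocks (Q : LeviSchubertQuadruple) : Subgroup (GL (Fin Q.N) ℂ) :=
  threeBlocks Q.N Q.p Q.lastEntry

/-- The reduction `(w̄, d̄, N̄, L̄)` of a quadruple with `w` not the identity. -/
def reduction (Q : LeviSchubertQuadruple) (hne : ¬ Q.IsIdentity) : LeviSchubertQuadruple where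
  N := Q.lastEntry - Q.p
  d := Q.d - Q.p
  d_pos := Nat.sub_pos_of_lt (Q.p_lt hne)
  d_lt := by
    have h1 := Q.p_lt hne
    have h2 := Q.d_lt_lastEntry hne
    omega
  w := Q.reducedW
  L := midImage Q.p Q.lastEntry Q.lastEntry_le Q.L
  isLevi := by
    obtain ⟨I, hI, hL⟩ := Q.isLevi
    refine ⟨{k | k + Q.p ∈ I} ∩ Set.Ioo 0 (Q.lastEntry - Q.p), Set.inter_subset_right, ?_⟩
    rw [hL, midImage_leviSubgroup]
    ext g
    simp only [mem_leviSubgroup, Set.mem_inter_iff, Set.mem_Ioo, not_and]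
    exact ⟨fun h k h0 h1 h2 => h k h0 h1 fun h3 => h2 h3 h0 h1,
      fun h k h0 h1 h2 => h k h0 h1 fun h3 => absurd h3 h2⟩

end LeviSchubertQuadruple

end

open scoped LinearAlgebra.Projectivization Topology
open LeviSchubert

/-! Put `m = ℓ_d`. Everything rests on one linear map, `ω ↦ e_1 ∧ ⋯ ∧ e_p ∧ ω` from `⋀^(d-p)
ℂ^(m-p)` to `⋀^d ℂ^N`, with `ℂ^(m-p)` spanned by `e_{p+1}, …, e_m`. It is injective and sends `e_w̄`
to `e_w`. A matrix in `P_p ∩ P_m` scales `e_1 ∧ ⋯ ∧ e_p` by a determinant, and its components in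
`e_1, …, e_p` die against that product. So on the image it acts projectively through its middle
block (`pluckerRep_smul_pluckerEmbedding`). Upper triangular matrices have upper triangular middle
blocks, and all of these occur, so the Borel orbit of `[e_w]` is the image of that of `[e_w̄]`. A
linear embedding of projective spaces is closed, hence `X(w)` is the image of `X(w̄)`
(`schubertVariety_eq_image`). A linear embedding also preserves local rings and relative open dense
subsets, because homogeneous polynomials extend along a linear retraction. This transfers normality
and the open orbit condition, once Borel subgroups of `L` are matched with those of `L̄`
(`isSphericalVariety_image_iff`). That `L` is block diagonal at `p` and at `m` comes from stability
(`le_blocks`): otherwise `L` contains a simple reflection which moves `[e_w]` out of the image of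
the embedding, hence out of `X(w)`. -/

namespace LeviSchubert

/-! ### Linear embeddings of projective spaces: Zariski topology, local rings, normality. -/

section LinearEmbedding

variable {V W : Type} [AddCommGroup V] [Module ℂ V] [AddCommGroup W] [Module ℂ W]

/-- The pullback of a polynomial function along a linear map. -/
noncomputable def polyComap (f : V →ₗ[ℂ] W) (F : MvPolynomial (Module.Dual ℂ W) ℂ) :
    MvPolynomial (Module.Dual ℂ V) ℂ :=
  MvPolynomial.rename f.dualMap F

theorem polyEval_polyComap (f : V →ₗ[ℂ] W) (F : MvPolynomial (Module.Dual ℂ W) ℂ) (v : V) :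
    polyEval (polyComap f F) v = polyEval F (f v) := by
  simp only [polyEval, polyComap, MvPolynomial.eval_rename]
  rfl

theorem isHomogeneous_polyComap (f : V →ₗ[ℂ] W) {F : MvPolynomial (Module.Dual ℂ W) ℂ} {n : ℕ}
    (hF : F.IsHomogeneous n) : (polyComap f F).IsHomogeneous n :=
  hF.rename_isHomogeneous

theorem polyEval_smul {F : MvPolynomial (Module.Dual ℂ V) ℂ} {n : ℕ} (hF : F.IsHomogeneous n)
    (c : ℂ) (v : V) : polyEval F (c • v) = c ^ n * polyEval F v := by
  rw [polyEval, polyEval, MvPolynomial.eval_eq, MvPolynomial.eval_eq, Finset.mul_sum]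
  refine Finset.sum_congr rfl fun a ha => ?_
  have hn : ∑ i ∈ a.support, a i = n := by
    rw [← hF (MvPolynomial.mem_support_iff.1 ha), Finsupp.weight_apply, Finsupp.sum]
    simp
  simp only [map_smul, smul_eq_mul, mul_pow, Finset.prod_mul_distrib, Finset.prod_pow_eq_pow_sum,
    hn]
  ring

theorem exists_rep_map (f : V →ₗ[ℂ] W) (hf : Function.Injective f) (x : ℙ ℂ V) :
    ∃ c : ℂ, c ≠ 0 ∧ (Projectivization.map f hf x).rep = c • f x.rep := by
  have h : Projectivization.map f hf x =
      Projectivization.mk ℂ (f x.rep) (fun h => x.rep_nonzero (hf (by rw [h, map_zero]))) := by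
    conv_lhs => rw [← x.mk_rep]
    rfl
  obtain ⟨a, ha⟩ := Projectivization.exists_smul_eq_mk_rep ℂ (f x.rep)
    (fun h => x.rep_nonzero (hf (by rw [h, map_zero])))
  exact ⟨a, a.ne_zero, by rw [h, ← ha]; rfl⟩

/-- The chosen representatives of `x` and of its image match only up to a scalar. That scalar is
independent of `F`, so it cancels in quotients of polynomials of equal degree. -/
theorem exists_polyEval_rep_map (f : V →ₗ[ℂ] W) (hf : Function.Injective f) (x : ℙ ℂ V) :
    ∃ c : ℂ, c ≠ 0 ∧ ∀ (n : ℕ) (F : MvPolynomial (Module.Dual ℂ W) ℂ), F.IsHomogeneous n →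
      polyEval F (Projectivization.map f hf x).rep = c ^ n * polyEval (polyComap f F) x.rep := by
  obtain ⟨c, hc, h⟩ := exists_rep_map f hf x
  exact ⟨c, hc, fun n F hF => by rw [h, polyEval_smul hF, polyEval_polyComap]⟩

theorem preimage_nonvanishing (f : V →ₗ[ℂ] W) (hf : Function.Injective f) {n : ℕ}
    {F : MvPolynomial (Module.Dual ℂ W) ℂ} (hF : F.IsHomogeneous n) :
    Projectivization.map f hf ⁻¹' nonvanishing F = nonvanishing (polyComap f F) := by
  ext x
  obtain ⟨c, hc, h⟩ := exists_polyEval_rep_map f hf x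
  simp only [nonvanishing, Set.mem_preimage, Set.mem_ofPred_eq, h n F hF, ne_eq, mul_eq_zero,
    pow_eq_zero_iff', hc, false_and, false_or]

theorem ratio_map (f : V →ₗ[ℂ] W) (hf : Function.Injective f) {n : ℕ}
    {F G : MvPolynomial (Module.Dual ℂ W) ℂ} (hF : F.IsHomogeneous n) (hG : G.IsHomogeneous n)
    (x : ℙ ℂ V) :
    ratio F G (Projectivization.map f hf x) = ratio (polyComap f F) (polyComap f G) x := by
  obtain ⟨c, hc, h⟩ := exists_polyEval_rep_map f hf x
  rw [ratio, ratio, h n F hF, h n G hG, mul_div_mul_left _ _ (pow_ne_zero _ hc)]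

/-- Pulling back along a retraction `r` extends any polynomial from `V` to `W`; this gives the
surjectivity half of the comparison of topologies and of local rings. -/
theorem polyComap_comp_leftInverse (f : V →ₗ[ℂ] W) {r : W →ₗ[ℂ] V} (hr : r ∘ₗ f = LinearMap.id)
    (F : MvPolynomial (Module.Dual ℂ V) ℂ) : polyComap f (polyComap r F) = F := by
  rw [polyComap, polyComap, MvPolynomial.rename_rename, ← LinearMap.coe_comp,
    LinearMap.dualMap_comp_dualMap, hr, LinearMap.dualMap_id]
  exact MvPolynomial.rename_id_apply F

theorem zariski_eq_induced (f : V →ₗ[ℂ] W) (hf : Function.Injective f) :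
    zariski V = (zariski W).induced (Projectivization.map f hf) := by
  obtain ⟨r, hr⟩ := f.exists_leftInverse_of_injective (LinearMap.ker_eq_bot.2 hf)
  rw [zariski, zariski, induced_generateFrom_eq]
  congr 1
  ext U
  constructor
  · rintro ⟨n, F, hF, rfl⟩
    refine ⟨_, ⟨n, polyComap r F, isHomogeneous_polyComap r hF, rfl⟩, ?_⟩
    rw [preimage_nonvanishing f hf (isHomogeneous_polyComap r hF), polyComap_comp_leftInverse f hr]
  · rintro ⟨_, ⟨n, F, hF, rfl⟩, rfl⟩
    exact ⟨n, _, isHomogeneous_polyComap f hF, preimage_nonvanishing f hf hF⟩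

theorem isInducing_map (f : V →ₗ[ℂ] W) (hf : Function.Injective f) :
    @Topology.IsInducing _ _ (zariski V) (zariski W) (Projectivization.map f hf) :=
  @Topology.IsInducing.mk _ _ (zariski V) (zariski W) _ (zariski_eq_induced f hf)

theorem isClosed_range_map (f : V →ₗ[ℂ] W) (hf : Function.Injective f) :
    @IsClosed _ (zariski W) (Set.range (Projectivization.map f hf)) := by
  let _ := zariski W
  obtain ⟨r, hr⟩ := f.exists_leftInverse_of_injective (LinearMap.ker_eq_bot.2 hf)
  -- The image of `f` is the kernel of `id - f ∘ r`, hence the common zero locus of the linear forms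
  -- `φ ∘ (id - f ∘ r)`.
  have h : (Set.range (Projectivization.map f hf))ᶜ = ⋃ φ : Module.Dual ℂ W,
      nonvanishing (MvPolynomial.X (φ ∘ₗ (LinearMap.id - f ∘ₗ r))) := by
    ext y
    simp only [Set.mem_compl_iff, Set.mem_iUnion, nonvanishing, Set.mem_ofPred_eq, polyEval,
      MvPolynomial.eval_X]
    rw [← not_iff_not, not_not, not_exists]
    simp only [not_not]
    constructor
    · rintro ⟨x, rfl⟩ φ
      obtain ⟨c, -, h⟩ := exists_rep_map f hf x
      have h2 : r (f x.rep) = x.rep := LinearMap.congr_fun hr _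
      simp [h, h2]
    · intro h
      have h1 : y.rep - f (r y.rep) = 0 :=
        (Module.forall_dual_apply_eq_zero_iff ℂ _).1 fun φ => h φ
      have h2 : r y.rep ≠ 0 := fun h0 => y.rep_nonzero (by simpa [h0] using h1)
      refine ⟨Projectivization.mk ℂ (r y.rep) h2, ?_⟩
      rw [Projectivization.map_mk]
      conv_rhs => rw [← y.mk_rep]
      congr 1
      exact (sub_eq_zero.1 h1).symm
  rw [← isOpen_compl_iff, h]
  exact isOpen_iUnion fun φ =>
    TopologicalSpace.isOpen_generateFrom_of_mem ⟨1, _, MvPolynomial.isHomogeneous_X _ _, rfl⟩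

theorem closure_image_map (f : V →ₗ[ℂ] W) (hf : Function.Injective f) (S : Set (ℙ ℂ V)) :
    @closure _ (zariski W) (Projectivization.map f hf '' S) =
      Projectivization.map f hf '' @closure _ (zariski V) S := by
  let _ := zariski V
  let _ := zariski W
  exact ((Topology.IsClosedEmbedding.mk ⟨isInducing_map f hf,
    Projectivization.map_injective f hf⟩ (isClosed_range_map f hf)).closure_image_eq S)

theorem map_zariskiNhds (f : V →ₗ[ℂ] W) (hf : Function.Injective f) (X : Set (ℙ ℂ V))
    (x : ℙ ℂ V) : (zariskiNhds X x).map (Projectivization.map f hf) =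
      zariskiNhds (Projectivization.map f hf '' X) (Projectivization.map f hf x) := by
  let _ := zariski V
  let _ := zariski W
  exact (Topology.IsEmbedding.mk (isInducing_map f hf)
    (Projectivization.map_injective f hf)).map_nhdsWithin_eq X x

/-- The pullback of germs along a map of filters. -/
noncomputable def germComap {α β : Type} {l : Filter α} {l' : Filter β} (g : α → β)
    (hg : Filter.Tendsto g l l') : Filter.Germ l' ℂ →+* Filter.Germ l ℂ where
  toFun φ := φ.compTendsto g hg
  map_one' := rfl
  map_zero' := rfl
  map_mul' φ ψ := by
    induction φ, ψ using Filter.Germ.inductionOn₂ with | _ a b => rfl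
  map_add' φ ψ := by
    induction φ, ψ using Filter.Germ.inductionOn₂ with | _ a b => rfl

/-- Injectivity needs the equality `l.map g = l'`, not just convergence: agreement after composing
with `g` must already hold along `l'`. For an embedding, `map_zariskiNhds` provides it. -/
theorem germComap_injective {α β : Type} {l : Filter α} {l' : Filter β} (g : α → β)
    (hg : l.map g = l') : Function.Injective (germComap g hg.le) := by
  subst hg
  intro φ ψ h
  induction φ, ψ using Filter.Germ.inductionOn₂ with | _ a b =>
  have h' : ((a ∘ g : α → ℂ) : Filter.Germ l ℂ) = (b ∘ g : α → ℂ) := h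
  have h2 : a ∘ g =ᶠ[l] b ∘ g := Filter.Germ.coe_eq.1 h'
  exact Filter.Germ.coe_eq.2 (Filter.eventually_map.2 h2)

theorem map_localRing (f : V →ₗ[ℂ] W) (hf : Function.Injective f) (X : Set (ℙ ℂ V))
    (x : ℙ ℂ V) :
    (localRing (Projectivization.map f hf '' X) (Projectivization.map f hf x)).map
      (germComap (Projectivization.map f hf) (map_zariskiNhds f hf X x).le) = localRing X x := by
  obtain ⟨r, hr⟩ := f.exists_leftInverse_of_injective (LinearMap.ker_eq_bot.2 hf)
  obtain ⟨c, hc, h⟩ := exists_polyEval_rep_map f hf x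
  ext ψ
  constructor
  · rintro ⟨_, ⟨n, F, G, hF, hG, hx, rfl⟩, rfl⟩
    refine ⟨n, polyComap f F, polyComap f G, isHomogeneous_polyComap f hF,
      isHomogeneous_polyComap f hG, ?_, ?_⟩
    · rw [h n G hG] at hx
      exact right_ne_zero_of_mul hx
    · exact congrArg _ (funext (ratio_map f hf hF hG))
  · rintro ⟨n, F, G, hF, hG, hx, rfl⟩
    have hF' := isHomogeneous_polyComap r hF
    have hG' := isHomogeneous_polyComap r hG
    refine ⟨_, ⟨n, polyComap r F, polyComap r G, hF', hG', ?_, rfl⟩, ?_⟩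
    · rw [h n _ hG', polyComap_comp_leftInverse f hr]
      exact mul_ne_zero (pow_ne_zero _ hc) hx
    · refine (congrArg _ (funext (ratio_map f hf hF' hG'))).trans ?_
      rw [polyComap_comp_leftInverse f hr, polyComap_comp_leftInverse f hr]
      rfl

/-- A linear embedding of projective spaces identifies the local rings of a subset and of its
image. -/
noncomputable def localRingEquiv (f : V →ₗ[ℂ] W) (hf : Function.Injective f) (X : Set (ℙ ℂ V))
    (x : ℙ ℂ V) :
    localRing (Projectivization.map f hf '' X) (Projectivization.map f hf x) ≃+* localRing X x :=
  (Subring.equivMapOfInjective _ _ (germComap_injective _ (map_zariskiNhds f hf X x))).trans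
    (RingEquiv.subringCongr (map_localRing f hf X x))

theorem isNormalVariety_image_map_iff (f : V →ₗ[ℂ] W) (hf : Function.Injective f)
    (X : Set (ℙ ℂ V)) :
    IsNormalVariety (Projectivization.map f hf '' X) ↔ IsNormalVariety X := by
  rw [IsNormalVariety, Set.forall_mem_image]
  refine forall₂_congr fun x _ => ?_
  let e := localRingEquiv f hf X x
  constructor
  · rintro ⟨h1, h2⟩
    exact ⟨e.symm.toMulEquiv.isDomain _, IsIntegrallyClosed.of_equiv e⟩
  · rintro ⟨h1, h2⟩
    exact ⟨e.toMulEquiv.isDomain _, IsIntegrallyClosed.of_equiv e.symm⟩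

theorem isOpenDenseIn_image_map_iff (f : V →ₗ[ℂ] W) (hf : Function.Injective f)
    (O X : Set (ℙ ℂ V)) :
    IsOpenDenseIn (Projectivization.map f hf '' O) (Projectivization.map f hf '' X) ↔
      IsOpenDenseIn O X := by
  have hinj := Projectivization.map_injective f hf
  rw [IsOpenDenseIn, IsOpenDenseIn, closure_image_map, Set.image_subset_image_iff hinj]
  refine and_congr_left fun _ => ⟨?_, ?_⟩
  · rintro ⟨U, hU, h⟩
    refine ⟨Projectivization.map f hf ⁻¹' U, ?_, ?_⟩
    · rw [zariski_eq_induced f hf]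
      exact ⟨U, hU, rfl⟩
    · rw [← hinj.preimage_image O, h, Set.preimage_inter, hinj.preimage_image]
  · rintro ⟨U, hU, rfl⟩
    rw [zariski_eq_induced f hf] at hU
    obtain ⟨U', hU', rfl⟩ := hU
    exact ⟨U', hU', Set.image_preimage_inter _ _ _⟩

end LinearEmbedding

/-! ### Exterior algebra: wedging with a fixed decomposable vector. -/

section Exterior

variable {R M M' : Type} [CommRing R] [AddCommGroup M] [Module R M] [AddCommGroup M'] [Module R M']

theorem ιMulti_mul_ι {p : ℕ} (u : Fin p → M) (v : M) :
    ExteriorAlgebra.ιMulti R p u * ExteriorAlgebra.ι R v =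
      (-1 : R) ^ p • (ExteriorAlgebra.ι R v * ExteriorAlgebra.ιMulti R p u) := by
  induction p with
  | zero => simp
  | succ p ih =>
    have h := ExteriorAlgebra.ι_add_mul_swap (R := R) (u 0) v
    rw [ExteriorAlgebra.ιMulti_succ_apply, mul_assoc, ih, mul_smul_comm, ← mul_assoc,
      eq_neg_of_add_eq_zero_left h, pow_succ, mul_smul, ← mul_assoc]
    simp

theorem ιMulti_mul_ι_self {p : ℕ} (u : Fin p → M) (i : Fin p) :
    ExteriorAlgebra.ιMulti R p u * ExteriorAlgebra.ι R (u i) = 0 := by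
  rw [ιMulti_mul_ι, ExteriorAlgebra.ιMulti_apply, ExteriorAlgebra.ι_mul_prod_list, smul_zero]

/-- Behind the product of the `u i`, a linear map matters only modulo vectors which that product
annihilates. In the induction the product is moved past each new factor, at the cost of a sign
common to both sides. -/
theorem ιMulti_mul_map_congr {p : ℕ} (u : Fin p → M) {f f' : M' →ₗ[R] M}
    (h : ∀ v, ExteriorAlgebra.ιMulti R p u * ExteriorAlgebra.ι R (f v) =
      ExteriorAlgebra.ιMulti R p u * ExteriorAlgebra.ι R (f' v)) (y : ExteriorAlgebra R M') :
    ExteriorAlgebra.ιMulti R p u * ExteriorAlgebra.map f y =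
      ExteriorAlgebra.ιMulti R p u * ExteriorAlgebra.map f' y := by
  induction y using CliffordAlgebra.left_induction with
  | algebraMap r => simp
  | add x y hx hy => simp only [map_add, mul_add, hx, hy]
  | ι_mul x v hx =>
    change _ * ExteriorAlgebra.map f (ExteriorAlgebra.ι R v * x) =
      _ * ExteriorAlgebra.map f' (ExteriorAlgebra.ι R v * x)
    rw [map_mul, map_mul, ExteriorAlgebra.map_apply_ι, ExteriorAlgebra.map_apply_ι, ← mul_assoc,
      ← mul_assoc, h, ιMulti_mul_ι, smul_mul_assoc, smul_mul_assoc, mul_assoc, mul_assoc, hx]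

/-- Contraction of the exterior algebra with a linear functional. -/
noncomputable def contract (δ : Module.Dual R M) : ExteriorAlgebra R M →ₗ[R] ExteriorAlgebra R M :=
  CliffordAlgebra.contractLeft (Q := (0 : QuadraticForm R M)) δ

theorem contract_ι_mul (δ : Module.Dual R M) (v : M) (x : ExteriorAlgebra R M) :
    contract δ (ExteriorAlgebra.ι R v * x) =
      δ v • x - ExteriorAlgebra.ι R v * contract δ x :=
  CliffordAlgebra.contractLeft_ι_mul δ v x

theorem contract_map_eq_zero (δ : Module.Dual R M) {f : M' →ₗ[R] M} (h : ∀ v, δ (f v) = 0)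
    (y : ExteriorAlgebra R M') :
    contract δ (ExteriorAlgebra.map f y) = 0 := by
  induction y using CliffordAlgebra.left_induction with
  | algebraMap r =>
    rw [AlgHom.commutes]
    exact CliffordAlgebra.contractLeft_algebraMap (0 : QuadraticForm R M) δ r
  | add x y hx hy => rw [map_add, map_add, hx, hy, add_zero]
  | ι_mul x v hx =>
    change contract δ (ExteriorAlgebra.map f (ExteriorAlgebra.ι R v * x)) = 0
    rw [map_mul, ExteriorAlgebra.map_apply_ι, contract_ι_mul, h, hx, zero_smul, mul_zero, sub_zero]

theorem contract_ιMulti_mul_eq_zero {p : ℕ} (δ : Module.Dual R M) {u : Fin p → M}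
    (hu : ∀ i, δ (u i) = 0) {y : ExteriorAlgebra R M} (hy : contract δ y = 0) :
    contract δ (ExteriorAlgebra.ιMulti R p u * y) = 0 := by
  induction p with
  | zero => simpa using hy
  | succ p ih =>
    rw [ExteriorAlgebra.ιMulti_succ_apply, mul_assoc, contract_ι_mul, hu, zero_smul, ih, mul_zero,
      sub_zero]
    exact fun i => hu _

/-- Contraction is an antiderivation. Contracting with `δ 0` strips off `u 0`, since `δ 0` kills the
other `u i` and contracts `y` to zero; induction removes the remaining factors. -/
theorem eq_zero_of_ιMulti_mul_eq_zero {p : ℕ} (δ : Fin p → Module.Dual R M) {u : Fin p → M}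
    (hu : ∀ i j, δ i (u j) = if i = j then 1 else 0) {y : ExteriorAlgebra R M}
    (hy : ∀ i, contract (δ i) y = 0)
    (h : ExteriorAlgebra.ιMulti R p u * y = 0) : y = 0 := by
  induction p with
  | zero => simpa using h
  | succ p ih =>
    refine ih (fun i => δ i.succ) (u := fun i => u i.succ) (fun i j => by simp [hu])
      (fun i => hy _) ?_
    rw [ExteriorAlgebra.ιMulti_succ_apply, mul_assoc] at h
    have h1 := (contract_ι_mul (δ 0) (u 0) _).symm.trans
      (congrArg (contract (δ 0)) h)
    rw [hu, if_pos rfl, one_smul, map_zero, contract_ιMulti_mul_eq_zero (δ 0) _ (hy 0)] at h1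
    · rw [mul_zero, sub_zero] at h1
      exact h1
    · intro i
      simp [hu, Matrix.vecTail, (Fin.succ_ne_zero i).symm]

/-- An alternating map is determined by its values on distinct basis vectors. With `p` vectors in
rank `p` these are permutations of the standard basis, where both sides change by the same sign. -/
theorem alternatingMap_apply_eq_det_smul {p : ℕ} (f : (Fin p → R) [⋀^Fin p]→ₗ[R] M)
    (A : Matrix (Fin p) (Fin p) R) : f A = A.det • f fun i => Pi.single i 1 := by
  have h : f = (LinearMap.toSpanSingleton R M (f fun i => Pi.single i 1)).compAlternatingMap
      Matrix.detRowAlternating := by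
    refine Module.Basis.ext_alternating (Pi.basisFun R (Fin p)) fun v hv => ?_
    let σ : Equiv.Perm (Fin p) := Equiv.ofBijective v (Finite.injective_iff_bijective.1 hv)
    have h1 : (fun i => Pi.basisFun R (Fin p) (v i)) =
        (fun i => Pi.single i (1 : R) : Fin p → Fin p → R) ∘ σ := by
      ext i; simp [σ]
    have h2 : Matrix.detRowAlternating (fun i => Pi.single i (1 : R) : Fin p → Fin p → R) = 1 := by
      have : (fun i => Pi.single i (1 : R) : Fin p → Fin p → R) = (1 : Matrix (Fin p) (Fin p) R) := by
        ext i j; simp [Matrix.one_apply, Pi.single_apply, eq_comm]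
      rw [this]
      exact Matrix.det_one
    rw [h1, AlternatingMap.map_perm, AlternatingMap.map_perm, LinearMap.compAlternatingMap_apply,
      h2, LinearMap.toSpanSingleton_apply, one_smul]
  conv_lhs => rw [h]
  rfl

theorem ιMulti_sum_smul {p : ℕ} (u : Fin p → M) (A : Matrix (Fin p) (Fin p) R) :
    ExteriorAlgebra.ιMulti R p (fun i => ∑ j, A i j • u j) =
      A.det • ExteriorAlgebra.ιMulti R p u := by
  have h := alternatingMap_apply_eq_det_smul
    ((ExteriorAlgebra.ιMulti R p).compLinearMap (Fintype.linearCombination R u)) A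
  simp only [AlternatingMap.compLinearMap_apply,
    Fintype.linearCombination_apply_single, one_smul] at h
  exact h

theorem coe_exteriorPower_map {n : ℕ} (f : M →ₗ[R] M') (x : ⋀[R]^n M) :
    (exteriorPower.map n f x : ExteriorAlgebra R M') = ExteriorAlgebra.map f x := by
  have h : (⋀[R]^n M').subtype ∘ₗ exteriorPower.map n f =
      (ExteriorAlgebra.map f).toLinearMap ∘ₗ (⋀[R]^n M).subtype := by
    ext v
    simp [ExteriorAlgebra.map_apply_ιMulti]
  exact LinearMap.congr_fun h x

/-- The linear map `ω ↦ u_1 ∧ ⋯ ∧ u_p ∧ f(ω)` of exterior powers. -/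
noncomputable def wedgeMap {p n d : ℕ} (h : p + n = d) (u : Fin p → M) (f : M' →ₗ[R] M) :
    ⋀[R]^n M' →ₗ[R] ⋀[R]^d M :=
  LinearMap.codRestrict _
    ((LinearMap.mulLeft R (ExteriorAlgebra.ιMulti R p u)) ∘ₗ
      (ExteriorAlgebra.map f).toLinearMap ∘ₗ (⋀[R]^n M').subtype)
    (fun x => by
      subst h
      have h1 : ExteriorAlgebra.ιMulti R p u ∈ ⋀[R]^p M :=
        (exteriorPower.ιMulti R p u).2
      have h2 : ExteriorAlgebra.map f x ∈ ⋀[R]^n M := by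
        rw [← coe_exteriorPower_map]
        exact Subtype.coe_prop _
      exact SetLike.mul_mem_graded h1 h2)

theorem coe_wedgeMap {p n d : ℕ} (h : p + n = d) (u : Fin p → M) (f : M' →ₗ[R] M)
    (x : ⋀[R]^n M') : (wedgeMap h u f x : ExteriorAlgebra R M) =
      ExteriorAlgebra.ιMulti R p u * ExteriorAlgebra.map f x := rfl

theorem wedgeMap_ιMulti {p n d : ℕ} (h : p + n = d) (u : Fin p → M) (f : M' →ₗ[R] M)
    (v : Fin n → M') : wedgeMap h u f (exteriorPower.ιMulti R n v) =
      exteriorPower.ιMulti R d (Fin.append u (f ∘ v) ∘ Fin.cast h.symm) := by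
  subst h
  ext
  rw [coe_wedgeMap, exteriorPower.ιMulti_apply_coe, exteriorPower.ιMulti_apply_coe,
    ExteriorAlgebra.map_apply_ιMulti, ExteriorAlgebra.ιMulti_mul_ιMulti]
  rfl

theorem wedgeMap_injective {p n d : ℕ} (h : p + n = d) {u : Fin p → M} {f : M' →ₗ[R] M}
    {r : M →ₗ[R] M'} (hr : r ∘ₗ f = LinearMap.id) (δ : Fin p → Module.Dual R M)
    (hu : ∀ i j, δ i (u j) = if i = j then 1 else 0) (hf : ∀ i v, δ i (f v) = 0) :
    Function.Injective (wedgeMap h u f : ⋀[R]^n M' →ₗ[R] ⋀[R]^d M) := by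
  rw [injective_iff_map_eq_zero]
  intro x hx
  have h1 : ExteriorAlgebra.map f (x : ExteriorAlgebra R M') = 0 :=
    eq_zero_of_ιMulti_mul_eq_zero δ hu (fun i => contract_map_eq_zero (δ i) (hf i) _)
      (congrArg Subtype.val hx)
  exact Subtype.ext (ExteriorAlgebra.map_injective ⟨r, hr⟩ (h1.trans (map_zero _).symm))

end Exterior

/-! ### The embedding by `e_1 ∧ ⋯ ∧ e_p` and its equivariance. -/

section PluckerShift

variable {N p m d : ℕ}

/-- The first `p` vectors of the standard basis of `ℂ^N`. -/
noncomputable def initialBasis (hp : p ≤ N) (i : Fin p) : Fin N → ℂ := Pi.single (Fin.castLE hp i) 1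

/-- The inclusion of the middle block `ℂ^(m-p)` into `ℂ^N`. -/
noncomputable def midInclusion (p : ℕ) (hm : m ≤ N) : (Fin (m - p) → ℂ) →ₗ[ℂ] (Fin N → ℂ) :=
  Fintype.linearCombination ℂ fun i => Pi.single (midIndex p hm i) 1

theorem midInclusion_single (hm : m ≤ N) (i : Fin (m - p)) :
    midInclusion p hm (Pi.single i 1) = Pi.single (midIndex p hm i) 1 := by
  rw [midInclusion, Fintype.linearCombination_apply_single, one_smul]

/-- The linear map `ω ↦ e_1 ∧ ⋯ ∧ e_p ∧ ω`, where `ω` is a `(d - p)`-vector of the middle block. -/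
noncomputable def pluckerShift (hd : p ≤ d) (hp : p ≤ N) (hm : m ≤ N) :
    PluckerSpace (m - p) (d - p) →ₗ[ℂ] PluckerSpace N d :=
  wedgeMap (Nat.add_sub_cancel' hd) (initialBasis hp) (midInclusion p hm)

theorem midIndex_injective (hm : m ≤ N) : Function.Injective (midIndex p hm) := by
  intro i j h
  have := congrArg Fin.val h
  simp only [midIndex] at this
  exact Fin.ext (by omega)

theorem pluckerShift_injective (hd : p ≤ d) (hp : p ≤ N) (hm : m ≤ N) :
    Function.Injective (pluckerShift hd hp hm) := by
  refine wedgeMap_injective (r := LinearMap.funLeft ℂ ℂ (midIndex p hm)) _ ?_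
    (fun i => LinearMap.proj (Fin.castLE hp i)) ?_ ?_
  · refine LinearMap.pi_ext' fun i => LinearMap.ext_ring ?_
    simp only [LinearMap.comp_apply, LinearMap.coe_single, midInclusion_single, LinearMap.id_apply]
    ext j
    simp [LinearMap.funLeft_apply, Pi.single_apply, (midIndex_injective hm).eq_iff]
  · intro i j
    simp [initialBasis, Pi.single_apply]
  · intro i v
    have h : (LinearMap.proj (R := ℂ) (φ := fun _ : Fin N => ℂ) (Fin.castLE hp i)) ∘ₗ
        midInclusion p hm = 0 := by
      refine LinearMap.pi_ext' fun j => LinearMap.ext_ring ?_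
      simp only [LinearMap.comp_apply, LinearMap.coe_single, midInclusion_single]
      refine Pi.single_eq_of_ne ?_ _
      simp only [ne_eq, Fin.ext_iff, midIndex, Fin.val_castLE]
      omega
    exact LinearMap.congr_fun h v

theorem toLin'_single (A : Matrix (Fin N) (Fin N) ℂ) (j : Fin N) :
    Matrix.toLin' A (Pi.single j 1) = ∑ i, A i j • Pi.single i (1 : ℂ) := by
  ext k
  simp [Matrix.toLin'_apply, Pi.single_apply]

/-- Multiplication by a block upper triangular matrix on the vectors `e_1 ∧ ⋯ ∧ e_p ∧ ω`. -/
theorem exists_map_pluckerShift (hd : p ≤ d) (hp : p ≤ N) (hm : m ≤ N)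
    {A : Matrix (Fin N) (Fin N) ℂ} (hAp : ∀ i j : Fin N, j.val < p → p ≤ i.val → A i j = 0)
    (hAm : ∀ i j : Fin N, j.val < m → m ≤ i.val → A i j = 0) :
    ∃ c : ℂ, ∀ x, exteriorPower.map d (Matrix.toLin' A) (pluckerShift hd hp hm x) =
      c • pluckerShift hd hp hm (exteriorPower.map (d - p)
        (Matrix.toLin' (A.submatrix (midIndex p hm) (midIndex p hm))) x) := by
  -- By `hAp`, `A` preserves the span of the first `p` basis vectors. The upper left block appears
  -- transposed, because the images of the basis vectors are its columns while `ιMulti_sum_smul`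
  -- reads rows.
  have h1 : ExteriorAlgebra.map (Matrix.toLin' A) (ExteriorAlgebra.ιMulti ℂ p (initialBasis hp)) =
      (Matrix.of fun i j => A (Fin.castLE hp j) (Fin.castLE hp i)).det •
        ExteriorAlgebra.ιMulti ℂ p (initialBasis hp) := by
    rw [ExteriorAlgebra.map_apply_ιMulti, ← ιMulti_sum_smul]
    congr 1
    funext i
    rw [Function.comp_apply, initialBasis, toLin'_single]
    symm
    refine Fintype.sum_of_injective (Fin.castLE hp) (Fin.castLE_injective hp) _ _ ?_
      fun _ => rfl
    intro k hk
    rw [hAp k _ i.isLt, zero_smul]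
    by_contra hkp
    exact hk ⟨⟨k.val, by omega⟩, rfl⟩
  have h2 : ∀ v, ExteriorAlgebra.ιMulti ℂ p (initialBasis hp) *
      ExteriorAlgebra.ι ℂ ((Matrix.toLin' A ∘ₗ midInclusion p hm) v) =
      ExteriorAlgebra.ιMulti ℂ p (initialBasis hp) * ExteriorAlgebra.ι ℂ ((midInclusion p hm ∘ₗ
        Matrix.toLin' (A.submatrix (midIndex p hm) (midIndex p hm))) v) := by
    let E := LinearMap.mulLeft ℂ (ExteriorAlgebra.ιMulti ℂ p (initialBasis hp)) ∘ₗ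
      ExteriorAlgebra.ι ℂ
    suffices h : E ∘ₗ (Matrix.toLin' A ∘ₗ midInclusion p hm) = E ∘ₗ (midInclusion p hm ∘ₗ
        Matrix.toLin' (A.submatrix (midIndex p hm) (midIndex p hm))) from LinearMap.congr_fun h
    refine LinearMap.pi_ext' fun i => LinearMap.ext_ring ?_
    simp only [LinearMap.comp_apply, LinearMap.coe_single, midInclusion_single]
    rw [toLin'_single, toLin'_single]
    simp only [map_sum, map_smul, midInclusion_single, Matrix.submatrix_apply]
    symm
    refine Fintype.sum_of_injective _ (midIndex_injective hm) _ _ ?_ fun _ => rfl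
    intro k hk
    -- Outside the middle block, a component along `e_k` with `k < p` repeats a factor of the
    -- product, and one with `m ≤ k` vanishes by `hAm`.
    by_cases hkp : k.val < p
    · have h3 : E (Pi.single k 1) = 0 := ιMulti_mul_ι_self (initialBasis hp) ⟨k.val, hkp⟩
      simp [h3]
    · have h3 : m ≤ k.val := by
        by_contra hkm
        exact hk ⟨⟨k.val - p, by omega⟩, Fin.ext (by simp only [midIndex]; omega)⟩
      rw [hAm k _ (by simp only [midIndex]; omega) h3, zero_smul]
  refine ⟨(Matrix.of fun i j => A (Fin.castLE hp j) (Fin.castLE hp i)).det,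
    fun x => Subtype.ext ?_⟩
  rw [coe_exteriorPower_map, pluckerShift, coe_wedgeMap, map_mul, h1, Submodule.coe_smul,
    coe_wedgeMap, coe_exteriorPower_map, smul_mul_assoc]
  congr 1
  have h3 := ιMulti_mul_map_congr _ h2 x
  rwa [← ExteriorAlgebra.map_comp_map, ← ExteriorAlgebra.map_comp_map] at h3

/-- The embedding of projective spaces given by `ω ↦ e_1 ∧ ⋯ ∧ e_p ∧ ω`. -/
noncomputable def pluckerEmbedding (hd : p ≤ d) (hp : p ≤ N) (hm : m ≤ N) :
    ℙ ℂ (PluckerSpace (m - p) (d - p)) → ℙ ℂ (PluckerSpace N d) :=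
  Projectivization.map (pluckerShift hd hp hm) (pluckerShift_injective hd hp hm)

theorem pluckerEmbedding_injective (hd : p ≤ d) (hp : p ≤ N) (hm : m ≤ N) :
    Function.Injective (pluckerEmbedding hd hp hm) :=
  Projectivization.map_injective _ _

theorem mem_maximalParabolic {k : ℕ} {g : GL (Fin N) ℂ} :
    g ∈ maximalParabolic N k ↔ ∀ i j : Fin N, j.val < k → k ≤ i.val → g i j = 0 := by
  have h : g ∈ maximalParabolic N k ↔
      ∀ i j : Fin N, decide (k ≤ j.val) < decide (k ≤ i.val) → g i j = 0 := Iff.rfl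
  rw [h]
  refine forall₂_congr fun i j => ?_
  rw [Bool.lt_iff, decide_eq_false_iff_not, decide_eq_true_eq, not_le, and_imp]

theorem pluckerRep_smul_pluckerEmbedding (hd : p ≤ d) (hp : p ≤ N) (hm : m ≤ N)
    {g : GL (Fin N) ℂ} (hgp : g ∈ maximalParabolic N p) (hgm : g ∈ maximalParabolic N m)
    {h : GL (Fin (m - p)) ℂ} (hgh : ∀ i j, h i j = g (midIndex p hm i) (midIndex p hm j))
    (x : ℙ ℂ (PluckerSpace (m - p) (d - p))) :
    pluckerRep N d g • pluckerEmbedding hd hp hm x =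
      pluckerEmbedding hd hp hm (pluckerRep (m - p) (d - p) h • x) := by
  obtain ⟨c, hc⟩ := exists_map_pluckerShift hd hp hm (mem_maximalParabolic.1 hgp)
    (mem_maximalParabolic.1 hgm)
  have hsub : (g : Matrix (Fin N) (Fin N) ℂ).submatrix (midIndex p hm) (midIndex p hm) = h := by
    ext i j
    exact (hgh i j).symm
  rw [hsub] at hc
  induction x with | h v hv =>
  simp only [pluckerEmbedding, Projectivization.smul_mk, Projectivization.map_mk]
  -- Nonvanishing of `c` need not be checked: both vectors are nonzero.
  exact (Projectivization.mk_eq_mk_iff' ℂ _ _ _ _).2 ⟨c, (hc v).symm⟩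

theorem pluckerEmbedding_basisPoint (hd : p ≤ d) (hp : p ≤ N) (hm : m ≤ N)
    (w : Fin d ↪o Fin N) (w' : Fin (d - p) ↪o Fin (m - p))
    (h1 : ∀ i : Fin d, i.val < p → (w i).val = i.val)
    (h2 : ∀ i : Fin (d - p), (w ⟨i.val + p, by omega⟩).val = (w' i).val + p) :
    pluckerEmbedding hd hp hm (basisPoint w') = basisPoint w := by
  rw [pluckerEmbedding, basisPoint, basisPoint, Projectivization.map_mk]
  congr 1
  rw [basisVector, basisVector, pluckerShift, wedgeMap_ιMulti]
  congr 1
  funext i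
  obtain ⟨i, rfl⟩ : ∃ j : Fin (p + (d - p)), i = Fin.cast (by omega) j :=
    ⟨Fin.cast (by omega) i, rfl⟩
  rw [Function.comp_apply, Fin.cast_cast, Fin.cast_eq_self]
  induction i using Fin.addCases with
  | left i =>
    rw [Fin.append_left, initialBasis]
    congr 1
    exact Fin.ext (h1 (Fin.cast (by omega) (Fin.castAdd (d - p) i)) i.isLt).symm
  | right i =>
    rw [Fin.append_right, Function.comp_apply, midInclusion_single]
    congr 1
    refine Fin.ext ((h2 i).symm.trans ?_)
    congr 2
    exact Fin.ext (Nat.add_comm _ _)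

theorem exists_eq_pluckerShift (hd : p ≤ d) (hp : p ≤ N) (hm : m ≤ N) {v : PluckerSpace N d}
    (hv : v ≠ 0)
    (h : Projectivization.mk ℂ v hv ∈ Set.range (pluckerEmbedding hd hp hm)) :
    ∃ x, v = pluckerShift hd hp hm x := by
  obtain ⟨x, hx⟩ := h
  induction x with | h x hx0 =>
  obtain ⟨c, hc⟩ := (Projectivization.mk_eq_mk_iff' ℂ _ _ _ _).1 hx.symm
  exact ⟨c • x, by rw [map_smul, hc]⟩

/-- The map forgetting the coordinate `a`. -/
noncomputable def killCoord (a : Fin N) : (Fin N → ℂ) →ₗ[ℂ] (Fin N → ℂ) :=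
  Matrix.toLin' (Matrix.diagonal (Function.update 1 a 0))

theorem killCoord_single_self (a : Fin N) : killCoord a (Pi.single a 1) = 0 := by
  simp [killCoord]

theorem killCoord_single_of_ne {a b : Fin N} (h : b ≠ a) :
    killCoord a (Pi.single b 1) = Pi.single b 1 := by
  simp [killCoord, h]

/-- This lemma and the next one are tests for membership in the image: every element involves each
`e_a` with `a < p`, and none involves `e_a` with `m ≤ a`. -/
theorem map_killCoord_pluckerShift_of_lt (hd : p ≤ d) (hp : p ≤ N) (hm : m ≤ N) {a : Fin N}
    (ha : a.val < p) (x : PluckerSpace (m - p) (d - p)) :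
    exteriorPower.map d (killCoord a) (pluckerShift hd hp hm x) = 0 := by
  ext
  rw [coe_exteriorPower_map, pluckerShift, coe_wedgeMap, map_mul, ExteriorAlgebra.map_apply_ιMulti,
    AlternatingMap.map_coord_zero _ ⟨a.val, ha⟩ (killCoord_single_self a), zero_mul]
  rfl

theorem map_killCoord_pluckerShift_of_le (hd : p ≤ d) (hp : p ≤ N) (hm : m ≤ N) (hpm : p ≤ m)
    {a : Fin N} (ha : m ≤ a.val) (x : PluckerSpace (m - p) (d - p)) :
    exteriorPower.map d (killCoord a) (pluckerShift hd hp hm x) = pluckerShift hd hp hm x := by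
  have h1 : killCoord a ∘ initialBasis hp = initialBasis hp := by
    funext i
    refine killCoord_single_of_ne ?_
    simp only [ne_eq, Fin.ext_iff, Fin.val_castLE]
    omega
  have h2 : killCoord a ∘ₗ midInclusion p hm = midInclusion p hm := by
    refine LinearMap.pi_ext' fun i => LinearMap.ext_ring ?_
    simp only [LinearMap.comp_apply, LinearMap.coe_single, midInclusion_single]
    refine killCoord_single_of_ne ?_
    simp only [ne_eq, Fin.ext_iff, midIndex]
    omega
  ext
  rw [coe_exteriorPower_map, pluckerShift, coe_wedgeMap, map_mul, ExteriorAlgebra.map_apply_ιMulti,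
    h1, ← AlgHom.comp_apply, ExteriorAlgebra.map_comp_map, h2]

end PluckerShift

/-! ### Middle blocks of subgroups, orbits, and transfer of stability and sphericity. -/

variable {N p m d : ℕ}

/-- Middle blocks multiply already for block triangular matrices: intermediate indices below `p` are
killed by `g`, those from `m` on by `h`. This is needed for the full Borel subgroup, on which
`midProj` is not defined. -/
theorem submatrix_midIndex_mul (hm : m ≤ N) {g h : GL (Fin N) ℂ}
    (hg : g ∈ maximalParabolic N p) (hh : h ∈ maximalParabolic N m) :
    (g : Matrix (Fin N) (Fin N) ℂ).submatrix (midIndex p hm) (midIndex p hm) *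
      (h : Matrix (Fin N) (Fin N) ℂ).submatrix (midIndex p hm) (midIndex p hm) =
      ((g * h : GL (Fin N) ℂ) : Matrix (Fin N) (Fin N) ℂ).submatrix
        (midIndex p hm) (midIndex p hm) := by
  ext i j
  simp only [Matrix.submatrix_apply, Matrix.mul_apply, Units.val_mul]
  symm
  refine sum_midIndex hm _ fun k hk => ?_
  by_cases hkp : k.val < p
  · rw [mem_maximalParabolic.1 hg _ k hkp (Nat.le_add_left _ _), zero_mul]
  · rw [mem_maximalParabolic.1 hh k _ (by simp only [midIndex]; omega) (by omega), mul_zero]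

theorem exists_midBlock (hm : m ≤ N) {g : GL (Fin N) ℂ}
    (hgp : g ∈ maximalParabolic N p) (hgm : g ∈ maximalParabolic N m) :
    ∃ h : GL (Fin (m - p)) ℂ, ∀ i j, h i j = g (midIndex p hm i) (midIndex p hm j) := by
  have h1 : (1 : Matrix (Fin N) (Fin N) ℂ).submatrix (midIndex p hm) (midIndex p hm) = 1 :=
    Matrix.submatrix_one _ (midIndex_injective hm)
  refine ⟨⟨(g : Matrix (Fin N) (Fin N) ℂ).submatrix (midIndex p hm) (midIndex p hm),
    ((g⁻¹ : GL (Fin N) ℂ) : Matrix (Fin N) (Fin N) ℂ).submatrix (midIndex p hm) (midIndex p hm),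
    ?_, ?_⟩, fun i j => rfl⟩
  · rw [submatrix_midIndex_mul hm hgp (inv_mem hgm), mul_inv_cancel, Units.val_one, h1]
  · rw [submatrix_midIndex_mul hm (inv_mem hgp) hgm, inv_mul_cancel, Units.val_one, h1]

theorem padUnit_midIndex (hm : m ≤ N) (h : GL (Fin (m - p)) ℂ) (i j : Fin (m - p)) :
    padUnit hm h (midIndex p hm i) (midIndex p hm j) = h i j := by
  rw [padUnit_apply, padMatrix, dif_pos (by simp only [midIndex]; omega)]
  have h1 : ∀ (k : Fin (m - p)) (hk : (midIndex p hm k).val - p < m - p),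
      (⟨(midIndex p hm k).val - p, hk⟩ : Fin (m - p)) = k := fun k hk =>
    Fin.ext (Nat.add_sub_cancel _ _)
  rw [h1, h1]

theorem mem_standardBorel {g : GL (Fin N) ℂ} :
    g ∈ standardBorel N ↔ ∀ i j : Fin N, j < i → g i j = 0 := Iff.rfl

theorem standardBorel_le_maximalParabolic (k : ℕ) : standardBorel N ≤ maximalParabolic N k :=
  fun _ hg => mem_maximalParabolic.2 fun i j hj hi =>
    mem_standardBorel.1 hg i j (Fin.lt_def.2 (hj.trans_le hi))

theorem padUnit_mem_standardBorel (hm : m ≤ N) {h : GL (Fin (m - p)) ℂ}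
    (hh : h ∈ standardBorel (m - p)) : padUnit hm h ∈ standardBorel N := by
  refine mem_standardBorel.2 fun i j hij => ?_
  rw [padUnit_apply, padMatrix]
  split_ifs with h1 h2
  · exact mem_standardBorel.1 hh _ _ (Fin.lt_def.2 (by rw [Fin.lt_def] at hij; simp only; omega))
  · exact absurd hij (by rw [h2]; exact lt_irrefl _)
  · rfl

theorem padUnit_mem_leviSubgroup (hm : m ≤ N) {I : Set ℕ} {h : GL (Fin (m - p)) ℂ}
    (hh : h ∈ leviSubgroup (m - p) {k | k + p ∈ I}) : padUnit hm h ∈ leviSubgroup N I := by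
  refine mem_leviSubgroup.2 fun k hk0 hk1 hkI i j hij => ?_
  have hne : i ≠ j := by
    rintro rfl
    exact hij Iff.rfl
  rw [padUnit_apply, padMatrix]
  split_ifs with h1
  · refine mem_leviSubgroup.1 hh (k - p) (by omega) (by omega) ?_ _ _ (by simp only; omega)
    rwa [Set.mem_ofPred_eq, Nat.sub_add_cancel (by omega)]
  · rfl

theorem orbit_pluckerEmbedding (hd : p ≤ d) (hp : p ≤ N) (hm : m ≤ N)
    {H : Subgroup (GL (Fin N) ℂ)} {H' : Subgroup (GL (Fin (m - p)) ℂ)}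
    (hHp : H ≤ maximalParabolic N p) (hHm : H ≤ maximalParabolic N m)
    (h1 : ∀ g ∈ H, ∃ h ∈ H', ∀ i j, h i j = g (midIndex p hm i) (midIndex p hm j))
    (h2 : ∀ h ∈ H', ∃ g ∈ H, ∀ i j, h i j = g (midIndex p hm i) (midIndex p hm j))
    (x : ℙ ℂ (PluckerSpace (m - p) (d - p))) :
    orbit H (pluckerEmbedding hd hp hm x) = pluckerEmbedding hd hp hm '' orbit H' x := by
  ext y
  constructor
  · rintro ⟨g, hg, rfl⟩
    obtain ⟨h, hh, hgh⟩ := h1 g hg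
    exact ⟨_, ⟨h, hh, rfl⟩,
      (pluckerRep_smul_pluckerEmbedding hd hp hm (hHp hg) (hHm hg) hgh x).symm⟩
  · rintro ⟨_, ⟨h, hh, rfl⟩, rfl⟩
    obtain ⟨g, hg, hgh⟩ := h2 h hh
    exact ⟨g, hg, (pluckerRep_smul_pluckerEmbedding hd hp hm (hHp hg) (hHm hg) hgh x).symm⟩

theorem schubertVariety_eq_image (hd : p ≤ d) (hp : p ≤ N) (hm : m ≤ N)
    {w : Fin d ↪o Fin N} {w' : Fin (d - p) ↪o Fin (m - p)}
    (h : pluckerEmbedding hd hp hm (basisPoint w') = basisPoint w) :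
    schubertVariety w = pluckerEmbedding hd hp hm '' schubertVariety w' := by
  rw [schubertVariety, ← h, orbit_pluckerEmbedding hd hp hm (H' := standardBorel (m - p))
    (standardBorel_le_maximalParabolic p) (standardBorel_le_maximalParabolic m)]
  · exact closure_image_map _ _ _
  · intro g hg
    obtain ⟨h, hh⟩ := exists_midBlock hm (standardBorel_le_maximalParabolic p hg)
      (standardBorel_le_maximalParabolic m hg)
    refine ⟨h, mem_standardBorel.2 fun i j hij => ?_, hh⟩
    rw [hh]
    exact mem_standardBorel.1 hg _ _ (Fin.lt_def.2 (Nat.add_lt_add_right hij p))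
  · exact fun h hh => ⟨padUnit hm h, padUnit_mem_standardBorel hm hh,
      fun i j => (padUnit_midIndex hm h i j).symm⟩

theorem mem_midImage {hm : m ≤ N} {L : Subgroup (GL (Fin N) ℂ)} {h : GL (Fin (m - p)) ℂ} :
    h ∈ midImage p m hm L ↔ ∃ g : threeBlocks N p m, (g : GL (Fin N) ℂ) ∈ L ∧
      midProj N p m hm g = h := Iff.rfl

theorem orbit_midImage (hd : p ≤ d) (hp : p ≤ N) (hm : m ≤ N) {H : Subgroup (GL (Fin N) ℂ)}
    (hH : H ≤ threeBlocks N p m) (x : ℙ ℂ (PluckerSpace (m - p) (d - p))) :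
    orbit H (pluckerEmbedding hd hp hm x) =
      pluckerEmbedding hd hp hm '' orbit (midImage p m hm H) x := by
  refine orbit_pluckerEmbedding hd hp hm (fun g hg => (hH hg).1.1) (fun g hg => (hH hg).2.1) ?_ ?_ x
  · exact fun g hg => ⟨_, mem_midImage.2 ⟨⟨g, hH hg⟩, hg, rfl⟩, fun i j => rfl⟩
  · rintro _ ⟨g, hg, rfl⟩
    exact ⟨g, hg, fun i j => rfl⟩

theorem isStableUnder_image_iff (hd : p ≤ d) (hp : p ≤ N) (hm : m ≤ N)
    {H : Subgroup (GL (Fin N) ℂ)} (hH : H ≤ threeBlocks N p m)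
    (X : Set (ℙ ℂ (PluckerSpace (m - p) (d - p)))) :
    IsStableUnder H (pluckerEmbedding hd hp hm '' X) ↔ IsStableUnder (midImage p m hm H) X := by
  constructor
  · rintro h _ ⟨g, hg, rfl⟩ x hx
    have h1 := h g hg _ (Set.mem_image_of_mem _ hx)
    rw [pluckerRep_smul_pluckerEmbedding hd hp hm g.2.1.1 g.2.2.1 (midProj_apply hm g)] at h1
    exact (pluckerEmbedding_injective hd hp hm).mem_set_image.1 h1
  · rintro h g hg _ ⟨x, hx, rfl⟩
    rw [pluckerRep_smul_pluckerEmbedding hd hp hm (hH hg).1.1 (hH hg).2.1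
      (midProj_apply hm ⟨g, hH hg⟩)]
    exact ⟨_, h _ (mem_midImage.2 ⟨⟨g, hH hg⟩, hg, rfl⟩) x hx, rfl⟩

/-- An upper triangular element of the projected group may have lifts in `L` that are not upper
triangular; the lift `diag(1, h, 1)` lies in both `L` and the Borel subgroup. -/
theorem midImage_standardBorel_inf (hm : m ≤ N) {I : Set ℕ}
    (hL : leviSubgroup N I ≤ threeBlocks N p m) :
    midImage p m hm (standardBorel N ⊓ leviSubgroup N I) =
      standardBorel (m - p) ⊓ midImage p m hm (leviSubgroup N I) := by
  ext h
  constructor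
  · rintro ⟨g, ⟨hgB, hgL⟩, rfl⟩
    exact ⟨mem_standardBorel.2 fun i j hij =>
      mem_standardBorel.1 hgB _ _ (Fin.lt_def.2 (Nat.add_lt_add_right hij p)),
      mem_midImage.2 ⟨g, hgL, rfl⟩⟩
  · rintro ⟨hB, hL'⟩
    rw [midImage_leviSubgroup] at hL'
    have h1 := padUnit_mem_leviSubgroup hm hL'
    refine mem_midImage.2 ⟨⟨_, hL h1⟩, ⟨padUnit_mem_standardBorel hm hB, h1⟩, ?_⟩
    ext i j
    exact padUnit_midIndex hm h i j

theorem midImage_map_conj (hm : m ≤ N) (g : threeBlocks N p m) {H : Subgroup (GL (Fin N) ℂ)}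
    (hH : H ≤ threeBlocks N p m) :
    midImage p m hm (H.map (MulAut.conj (g : GL (Fin N) ℂ)).toMonoidHom) =
      (midImage p m hm H).map (MulAut.conj (midProj N p m hm g)).toMonoidHom := by
  ext y
  constructor
  · rintro ⟨x, ⟨h, hh, hx⟩, rfl⟩
    refine ⟨_, mem_midImage.2 ⟨⟨h, hH hh⟩, hh, rfl⟩, ?_⟩
    have h1 : x = g * ⟨h, hH hh⟩ * g⁻¹ := Subtype.ext hx.symm
    rw [h1, map_mul, map_mul, map_inv]
    rfl
  · rintro ⟨_, ⟨h, hh, rfl⟩, rfl⟩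
    refine mem_midImage.2 ⟨g * h * g⁻¹, ⟨h, hh, rfl⟩, ?_⟩
    rw [map_mul, map_mul, map_inv]
    rfl

theorem isSphericalVariety_image_iff (hd : p ≤ d) (hp : p ≤ N) (hm : m ≤ N) {I : Set ℕ}
    (hL : leviSubgroup N I ≤ threeBlocks N p m) (X : Set (ℙ ℂ (PluckerSpace (m - p) (d - p)))) :
    IsSphericalVariety (leviSubgroup N I) (pluckerEmbedding hd hp hm '' X) ↔
      IsSphericalVariety (midImage p m hm (leviSubgroup N I)) X := by
  have hconj : ∀ (g : threeBlocks N p m), (g : GL (Fin N) ℂ) ∈ leviSubgroup N I →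
      (standardBorel N ⊓ leviSubgroup N I).map (MulAut.conj (g : GL (Fin N) ℂ)).toMonoidHom ≤
        threeBlocks N p m := by
    rintro g - _ ⟨h, hh, rfl⟩
    exact mul_mem (mul_mem g.2 (hL hh.2)) (inv_mem g.2)
  have hmid : ∀ g : threeBlocks N p m,
      midImage p m hm ((standardBorel N ⊓ leviSubgroup N I).map
        (MulAut.conj (g : GL (Fin N) ℂ)).toMonoidHom) =
      (standardBorel (m - p) ⊓ midImage p m hm (leviSubgroup N I)).map
        (MulAut.conj (midProj N p m hm g)).toMonoidHom := fun g => by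
    rw [midImage_map_conj hm g (inf_le_right.trans hL), midImage_standardBorel_inf hm hL]
  refine and_congr (isNormalVariety_image_map_iff _ _ X) ⟨?_, ?_⟩
  · rintro ⟨_, ⟨g, hg, rfl⟩, _, ⟨x, hx, rfl⟩, hO⟩
    let g' : threeBlocks N p m := ⟨g, hL hg⟩
    refine ⟨_, ⟨midProj N p m hm g', mem_midImage.2 ⟨g', hg, rfl⟩, rfl⟩, x, hx, ?_⟩
    rw [orbit_midImage hd hp hm (hconj g' hg)] at hO
    rw [← hmid g']
    exact (isOpenDenseIn_image_map_iff _ _ _ _).1 hO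
  · rintro ⟨_, ⟨_, ⟨g, hg, rfl⟩, rfl⟩, x, hx, hO⟩
    refine ⟨_, ⟨g, hg, rfl⟩, _, Set.mem_image_of_mem _ hx, ?_⟩
    rw [orbit_midImage hd hp hm (hconj g hg), hmid g]
    exact (isOpenDenseIn_image_map_iff _ _ _ _).2 hO

/-! ### Simple reflections and the containment of `L` in the three blocks. -/

theorem swap_mem_leviSubgroup {I : Set ℕ} {k : ℕ} (hk : k ∈ I) {a b : Fin N}
    (ha : a.val + 1 = k) (hb : b.val = k) :
    Matrix.GeneralLinearGroup.swap ℂ a b ∈ leviSubgroup N I := by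
  refine mem_leviSubgroup.2 fun k' _ _ hk' i j hij => ?_
  have hne : k' ≠ k := by
    rintro rfl
    exact hk' hk
  change Matrix.swap ℂ a b i j = 0
  rw [Matrix.swap, Equiv.Perm.permMatrix, PEquiv.toMatrix_apply, if_neg]
  simp only [Equiv.toPEquiv_apply, Option.mem_some_iff]
  rintro rfl
  refine hij ?_
  rcases eq_or_ne i a with rfl | hia
  · rw [Equiv.swap_apply_left]
    omega
  · rcases eq_or_ne i b with rfl | hib
    · rw [Equiv.swap_apply_right]
      omega
    · rw [Equiv.swap_apply_of_ne_of_ne hia hib]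

theorem toLin'_swap_single (a b j : Fin N) :
    Matrix.toLin' (Matrix.swap ℂ a b) (Pi.single j 1) = Pi.single (Equiv.swap a b j) 1 := by
  rw [Matrix.toLin'_apply, Matrix.swap_mulVec]
  ext i
  simp only [Function.comp_apply, Pi.single_apply, Equiv.swap_apply_eq_iff]

theorem exists_swap_pluckerShift (hd : p ≤ d) (hp : p ≤ N) (hm : m ≤ N) {w : Fin d ↪o Fin N}
    {a b : Fin N} (h : pluckerRep N d (Matrix.GeneralLinearGroup.swap ℂ a b) • basisPoint w ∈
      Set.range (pluckerEmbedding hd hp hm)) :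
    exteriorPower.ιMulti ℂ d (fun i => (Pi.single (Equiv.swap a b (w i)) 1 : Fin N → ℂ)) ≠ 0 ∧
      ∃ x, exteriorPower.ιMulti ℂ d (fun i => (Pi.single (Equiv.swap a b (w i)) 1 : Fin N → ℂ)) =
        pluckerShift hd hp hm x := by
  rw [basisPoint, Projectivization.smul_mk] at h
  have h1 : pluckerRep N d (Matrix.GeneralLinearGroup.swap ℂ a b) • basisVector w =
      exteriorPower.ιMulti ℂ d (fun i => (Pi.single (Equiv.swap a b (w i)) 1 : Fin N → ℂ)) := by
    change exteriorPower.map d (Matrix.toLin' (Matrix.swap ℂ a b)) (basisVector w) = _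
    rw [basisVector, exteriorPower.map_apply_ιMulti]
    congr 1
    funext i
    exact toLin'_swap_single a b (w i)
  rw [← h1]
  exact ⟨(smul_ne_zero_iff_ne _).2 (basisVector_ne_zero w), exists_eq_pluckerShift hd hp hm _ h⟩

/-- The guarded hypothesis covers `p = 0` and `ℓ_d = N`, where splitting imposes no condition. -/
theorem leviSubgroup_le_splitAt {I : Set ℕ} {k : ℕ} (h : 0 < k → k < N → k ∉ I) :
    leviSubgroup N I ≤ splitAt N k := by
  intro g hg
  refine mem_splitAt.2 fun i j hij => ?_
  exact mem_leviSubgroup.1 hg k (by omega) (by omega) (h (by omega) (by omega)) i j hij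

end LeviSchubert

namespace LeviSchubertQuadruple

/-- Equality could occur only at `i = p`, and would then contradict the maximality of `p`. Numbered
from zero, the index `p` is thus not an entry of `w`. -/
theorem p_lt_w (Q : LeviSchubertQuadruple) (i : Fin Q.d) (hi : Q.p ≤ i.val) :
    Q.p < (Q.w i).val := by
  have h1 := Q.le_w i.val i.isLt
  have hpd : Q.p < Q.d := hi.trans_lt i.isLt
  rcases hi.lt_or_eq with h | h
  · exact h.trans_le h1
  · refine lt_of_le_of_ne (hi.trans h1) fun hw => ?_
    have h2 : Q.p + 1 ≤ Q.p := by
      refine Nat.le_findGreatest hpd fun j hj => ?_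
      rcases (Nat.lt_succ_iff.1 hj).lt_or_eq with h3 | h3
      · exact Q.p_spec j h3
      · have h4 : j = i := Fin.ext (h3.trans h)
        rw [h4, ← hw, h]
    omega

theorem basisPoint_mem_X (Q : LeviSchubertQuadruple) : basisPoint Q.w ∈ Q.X := by
  let _ := zariski (PluckerSpace Q.N Q.d)
  exact subset_closure ⟨1, one_mem _, by rw [map_one, one_smul]⟩

theorem le_blocks (Q : LeviSchubertQuadruple) (hne : ¬ Q.IsIdentity) (hst : Q.IsStable)
    (hd : Q.p ≤ Q.d) (hp : Q.p ≤ Q.N)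
    (hX : Q.X ⊆ Set.range (pluckerEmbedding hd hp Q.lastEntry_le)) : Q.L ≤ Q.blocks := by
  obtain ⟨I, -, hL⟩ := Q.isLevi
  have hpd := Q.p_lt hne
  have hdl := Q.d_lt_lastEntry hne
  have key : ∀ k ∈ I, ∀ a b : Fin Q.N, a.val + 1 = k → b.val = k → _ := fun k hk a b ha hb =>
    exists_swap_pluckerShift hd hp Q.lastEntry_le (hX (hst _
      (by rw [hL]; exact swap_mem_leviSubgroup hk ha hb) _ Q.basisPoint_mem_X))
  rw [hL]
  refine le_inf (leviSubgroup_le_splitAt fun h0 h1 hI => ?_)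
    (leviSubgroup_le_splitAt fun h0 h1 hI => ?_)
  -- Since the index `p` is missing from `w`, exchanging `p - 1` and `p` removes `e_{p-1}` (numbered
  -- from zero) from the wedge. Killing that coordinate then fixes the vector, yet annihilates the
  -- image of the embedding, so the vector would be zero.
  · obtain ⟨hne0, x, hx⟩ := key _ hI ⟨Q.p - 1, by omega⟩ ⟨Q.p, h1⟩ (Nat.sub_add_cancel h0) rfl
    refine hne0 ?_
    have h2 := map_killCoord_pluckerShift_of_lt hd hp Q.lastEntry_le (a := ⟨Q.p - 1, by omega⟩)
      (Nat.sub_lt h0 Nat.one_pos) x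
    rw [← hx, exteriorPower.map_apply_ιMulti] at h2
    rw [← h2]
    congr 1
    funext i
    refine (killCoord_single_of_ne fun h3 => ?_).symm
    rw [Equiv.swap_apply_eq_iff, Equiv.swap_apply_left] at h3
    have h4 : (Q.w i).val = Q.p := congrArg Fin.val h3
    rcases lt_or_ge i.val Q.p with h5 | h5
    · have := Q.p_spec i h5
      omega
    · have := Q.p_lt_w i h5
      omega
  -- Here the reflection turns the last factor into the basis vector of index `ℓ_d` (numbered from
  -- zero). Killing that coordinate annihilates the vector, but fixes the image of the embedding.
  · have hsub : Q.lastEntry - 1 < Q.N := by omega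
    obtain ⟨hne0, x, hx⟩ := key _ hI ⟨Q.lastEntry - 1, hsub⟩ ⟨Q.lastEntry, h1⟩
      (Nat.sub_add_cancel h0) rfl
    refine hne0 ?_
    have h2 := map_killCoord_pluckerShift_of_le hd hp Q.lastEntry_le (by omega)
      (a := ⟨Q.lastEntry, h1⟩) le_rfl x
    rw [← hx, exteriorPower.map_apply_ιMulti] at h2
    rw [← h2]
    refine AlternatingMap.map_coord_zero _ ⟨Q.d - 1, Nat.sub_lt Q.d_pos Nat.one_pos⟩ ?_
    have h3 : Q.w ⟨Q.d - 1, Nat.sub_lt Q.d_pos Nat.one_pos⟩ = ⟨Q.lastEntry - 1, hsub⟩ :=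
      Fin.ext (Nat.add_sub_cancel _ 1).symm
    rw [Function.comp_apply, h3, Equiv.swap_apply_left, killCoord_single_self]

end LeviSchubertQuadruple

/-- For a stable quadruple with `w` not the identity, `L` lies in the group on which the
projection defining `L̄` is given, the reduction is stable, and the quadruple is spherical if
and only if its reduction is. -/
theorem propositionl (Q : LeviSchubertQuadruple) (hne : ¬ Q.IsIdentity) (hst : Q.IsStable) :
    Q.L ≤ Q.blocks ∧ (Q.reduction hne).IsStable ∧
      (Q.IsSpherical ↔ (Q.reduction hne).IsSpherical) := by
  have hd : Q.p ≤ Q.d := Q.p_le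
  have hp : Q.p ≤ Q.N := hd.trans Q.d_lt.le
  have hX : Q.X = pluckerEmbedding hd hp Q.lastEntry_le '' schubertVariety Q.reducedW := by
    refine schubertVariety_eq_image hd hp Q.lastEntry_le
      (pluckerEmbedding_basisPoint hd hp Q.lastEntry_le _ _ Q.p_spec fun i => ?_)
    have h := Q.le_w (i.val + Q.p) (by omega)
    exact (Nat.sub_add_cancel (by omega)).symm
  have hL : Q.L ≤ Q.blocks := Q.le_blocks hne hst hd hp (hX ▸ Set.image_subset_range _ _)
  have hst' : (Q.reduction hne).IsStable := by
    have h1 := hst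
    rw [LeviSchubertQuadruple.IsStable, hX] at h1
    exact (isStableUnder_image_iff hd hp Q.lastEntry_le hL _).1 h1
  refine ⟨hL, hst', and_congr (iff_of_true hst hst') ?_⟩
  obtain ⟨I, -, hI⟩ := Q.isLevi
  have h1 := isSphericalVariety_image_iff hd hp Q.lastEntry_le (I := I) (hI ▸ hL)
    (schubertVariety Q.reducedW)
  rwa [← hX, ← hI] at h1
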